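/- Let $\sigma=\sigma_1\cdots\sigma_m$ be a permutation of $\{1,\dots,m\}$. An interval of $\sigma$ is a nonempty set $\{j,j+1,\dots,j+h\}$ of consecutive values that is equal to $\{\sigma_i,\sigma_{i+1},\dots,\sigma_{i+h}\}$ for some $i$. The interval poset $P(\sigma)$ is the set of intervals of $\sigma$ ordered by inclusion, embedded in the plane so that its minimal elements appear in the order $\{1\},\{2\},\dots,\{m\}$ from left to right; the modified interval poset $\tilde P(\sigma)$ is the same poset, embedded so that its minimal elements appear in the order $\{\sigma_1\},\{\sigma_2\},\dots,\{\sigma_m\}$ from left to right. Elements are unlabelled: two such plane posets are considered equal if there is an isomorphism of posets between them that preserves the left-to-right order of the minimal elements. Theorem. For every $n\ge 1$, the number $p_n$ of distinct interval posets (of permutations of arbitrary size) with exactly $n$ minimal elements is finite and $$ p_n=\begin{cases}1 & \text{if } n=1,\\[4pt] \displaystyle\frac1n\sum_{i=1}^{n-1}\ \sum_{k=0}^{\min\{i,\lfloor (n-i-1)/2\rfloor\}}\binom{n+i-1}{i}\binom{i}{k}\binom{n-2k-2}{i-1} & \text{if } n>1.\end{cases} $$ This holds both for the interval posets $P(\sigma)$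 and for the modified interval posets $\tilde P(\sigma)$. -/

import Mathlib

/-- A nonempty finset `S` of values is an interval of the permutation `σ` if it is an interval
`[c, d]` of values which is the image under `σ` of an interval `[a, b]` of positions. -/
def IsPermInterval {m : ℕ} (σ : Equiv.Perm (Fin m)) (S : Finset (Fin m)) : Prop :=
  ∃ a b c d : Fin m, a ≤ b ∧ c ≤ d ∧ S = Finset.Icc c d ∧ S = (Finset.Icc a b).image σ

/-- The nonempty intervals of `σ`; as a subtype of finsets it is ordered by inclusion. -/
abbrev PermInterval {m : ℕ} (σ : Equiv.Perm (Fin m)) : Type :=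
  {S : Finset (Fin m) // IsPermInterval σ S}

/-- A poset with a plane embedding, recorded as the poset together with the left-to-right
(strict, total) order in which its minimal elements appear. The relation `left` is only
meaningful on minimal elements. -/
structure PlanePoset where
  carrier : Type
  order : PartialOrder carrier
  left : carrier → carrier → Prop
  left_irrefl : ∀ x, IsMin x → ¬ left x x
  left_trans : ∀ x y z, IsMin x → IsMin y → IsMin z → left x y → left y z → left x z
  left_total : ∀ x y, IsMin x → IsMin y → left x y ∨ x = y ∨ left y x

attribute [instance] PlanePoset.order

/-- Two plane posets are the same if there is an isomorphism of posets between them that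
preserves the left-to-right order of the minimal elements. -/
def PlanePoset.Same (A B : PlanePoset) : Prop :=
  ∃ e : A.carrier ≃o B.carrier,
    ∀ x y, IsMin x → IsMin y → (A.left x y ↔ B.left (e x) (e y))

theorem PlanePoset.same_equivalence : Equivalence PlanePoset.Same where
  refl A := ⟨OrderIso.refl _, fun _ _ _ _ => Iff.rfl⟩
  symm := by
    rintro A B ⟨e, he⟩
    refine ⟨e.symm, fun x y hx hy => ?_⟩
    have h := he (e.symm x) (e.symm y) ((OrderIso.isMin_apply e.symm).2 hx)
      ((OrderIso.isMin_apply e.symm).2 hy)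
    simpa using h.symm
  trans := by
    rintro A B C ⟨e, he⟩ ⟨f, hf⟩
    refine ⟨e.trans f, fun x y hx hy => ?_⟩
    exact (he x y hx hy).trans
      (hf (e x) (e y) ((OrderIso.isMin_apply e).2 hx) ((OrderIso.isMin_apply e).2 hy))

instance PlanePoset.setoid : Setoid PlanePoset := ⟨PlanePoset.Same, PlanePoset.same_equivalence⟩

/-- Plane posets up to the identification `PlanePoset.Same`. -/
abbrev PlanePosetClass : Type 1 := Quotient PlanePoset.setoid

theorem isPermInterval_singleton {m : ℕ} (σ : Equiv.Perm (Fin m)) (i : Fin m) :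
    IsPermInterval σ {i} :=
  ⟨σ.symm i, σ.symm i, i, i, le_rfl, le_rfl, by simp, by simp⟩

theorem PermInterval.eq_singleton_of_isMin {m : ℕ} {σ : Equiv.Perm (Fin m)}
    {S : PermInterval σ} (hS : IsMin S) : ∃ i : Fin m, S.1 = {i} := by
  obtain ⟨a, b, c, d, hab, hcd, h1, h2⟩ := S.2
  have hc : c ∈ S.1 := by rw [h1]; simp [hcd]
  have hle : (⟨{c}, isPermInterval_singleton σ c⟩ : PermInterval σ) ≤ S :=
    Finset.singleton_subset_iff.2 hc
  exact ⟨c, Finset.Subset.antisymm (hS hle) hle⟩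

/-- The interval poset `P(σ)`: the nonempty intervals of `σ` ordered by inclusion, the minimal
elements appearing in the order `{1}, {2}, …, {m}` from left to right. -/
def intervalPoset {m : ℕ} (σ : Equiv.Perm (Fin m)) : PlanePoset where
  carrier := PermInterval σ
  order := inferInstance
  left S T := ∃ i j : Fin m, S.1 = {i} ∧ T.1 = {j} ∧ i < j
  left_irrefl := by
    rintro S - ⟨i, j, hi, hj, hij⟩
    exact hij.ne (Finset.singleton_injective (hi.symm.trans hj))
  left_trans := by
    rintro S T U - - - ⟨i, j, hi, hj, hij⟩ ⟨j', k, hj', hk, hjk⟩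
    have hjj : j = j' := Finset.singleton_injective (hj.symm.trans hj')
    subst hjj
    exact ⟨i, k, hi, hk, hij.trans hjk⟩
  left_total := by
    intro S T hS hT
    obtain ⟨i, hi⟩ := PermInterval.eq_singleton_of_isMin hS
    obtain ⟨j, hj⟩ := PermInterval.eq_singleton_of_isMin hT
    rcases lt_trichotomy i j with h | h | h
    · exact Or.inl ⟨i, j, hi, hj, h⟩
    · exact Or.inr (Or.inl (Subtype.ext (by rw [hi, hj, h])))
    · exact Or.inr (Or.inr ⟨j, i, hj, hi, h⟩)

/-- The modified interval poset of `σ`: the nonempty intervals of `σ` ordered by inclusion, the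
minimal elements appearing in the order `{σ 1}, {σ 2}, …, {σ m}` from left to right. -/
def modifiedIntervalPoset {m : ℕ} (σ : Equiv.Perm (Fin m)) : PlanePoset where
  carrier := PermInterval σ
  order := inferInstance
  left S T := ∃ i j : Fin m, S.1 = {σ i} ∧ T.1 = {σ j} ∧ i < j
  left_irrefl := by
    rintro S - ⟨i, j, hi, hj, hij⟩
    exact hij.ne (σ.injective (Finset.singleton_injective (hi.symm.trans hj)))
  left_trans := by
    rintro S T U - - - ⟨i, j, hi, hj, hij⟩ ⟨j', k, hj', hk, hjk⟩
    have hjj : j = j' := σ.injective (Finset.singleton_injective (hj.symm.trans hj'))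
    subst hjj
    exact ⟨i, k, hi, hk, hij.trans hjk⟩
  left_total := by
    intro S T hS hT
    obtain ⟨i, hi⟩ := PermInterval.eq_singleton_of_isMin hS
    obtain ⟨j, hj⟩ := PermInterval.eq_singleton_of_isMin hT
    rcases lt_trichotomy (σ.symm i) (σ.symm j) with h | h | h
    · exact Or.inl ⟨_, _, by simpa using hi, by simpa using hj, h⟩
    · exact Or.inr (Or.inl (Subtype.ext (by rw [hi, hj, σ.symm.injective h])))
    · exact Or.inr (Or.inr ⟨_, _, by simpa using hj, by simpa using hi, h⟩)

/-- The number of minimal elements of a plane poset. -/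
noncomputable def PlanePoset.numMinimal (A : PlanePoset) : ℕ :=
  Set.ncard {x : A.carrier | IsMin x}

/-- The set of all interval posets `P(σ)` (`σ` a permutation of any size) that have exactly `n`
minimal elements, as plane posets. -/
def intervalPosets (n : ℕ) : Set PlanePosetClass :=
  {Q | ∃ (m : ℕ) (σ : Equiv.Perm (Fin m)),
    (intervalPoset σ).numMinimal = n ∧ Q = ⟦intervalPoset σ⟧}

/-- The set of all modified interval posets (of permutations of any size) that have exactly `n`
minimal elements, as plane posets. -/
def modifiedIntervalPosets (n : ℕ) : Set PlanePosetClass :=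
  {Q | ∃ (m : ℕ) (σ : Equiv.Perm (Fin m)),
    (modifiedIntervalPoset σ).numMinimal = n ∧ Q = ⟦modifiedIntervalPoset σ⟧}

/-- The closed formula: `1` for `n = 1`, and for `n > 1` the double binomial sum divided by `n`.
For `1 ≤ i ≤ n - 1` and `0 ≤ k ≤ (n - i - 1) / 2` no subtraction below truncates, and the
natural-number division is the floor, as it has to be in the bound of a summation. -/
def intervalPosetFormula (n : ℕ) : ℚ :=
  if n = 1 then 1
  else (1 / (n : ℚ)) * ∑ i ∈ Finset.Icc 1 (n - 1),
    ∑ k ∈ Finset.Icc 0 (min i ((n - i - 1) / 2)),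
      ((n + i - 1).choose i : ℚ) * (i.choose k : ℚ) * ((n - 2 * k - 2).choose (i - 1) : ℚ)

/-! An isomorphism of interval posets that respects the order of the minimal elements fixes every
singleton, hence every interval. So `P(σ)` amounts to the family of value intervals of `σ`, and
inverting `σ` turns modified posets into ordinary ones (`same_intervalPoset_iff`,
`same_modifiedIntervalPoset`).

The families that occur are exactly the forests containing the whole interval, the trees
(`range_permFamily`). Overlapping intervals of a permutation are closed under union, intersection
and difference, and no permutation of length three is simple, which gives the axiom on triples
(`isForest_contiguous`). Conversely, the root of a tree with more than one leaf is of one of two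
kinds: linear, where all unions of consecutive blocks are members and there are at least two blocks,
or prime, where no union of several blocks except the whole is a member and there are at least four
blocks. Such a root is realized by inflating an increasing, respectively a simple, arrangement of
the blocks (`exists_eq_contiguous`).

Removing the root leaves an arbitrary forest with at least two, respectively four, blocks
(`card_trees`), and a forest is a sequence of trees. Hence the generating function satisfies `T = X
+ (T^2 + T^4) / (1 - T)`, that is `T (1 - w(T)) = X` with `w = X (1 + X^2) / (1 - X)`. Lagrange
inversion gives `n [X^n] T = [X^(n-1)] (1 - w)^(-n)`, whose expansion is the double sum
(`card_trees_eq_formula`). -/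

/-! ### Forests of intervals, cuts and blocks. -/

/-- A family `F` of half-open intervals `[x, y) ⊆ [0, n)` is a forest if it contains all the
singletons, is closed under the boolean operations on overlapping intervals, and if no member
splits into exactly three members whose adjacent unions are both missing. -/
structure IsForest (n : ℕ) (F : ℕ → ℕ → Prop) : Prop where
  lt : ∀ {x y}, F x y → x < y
  le : ∀ {x y}, F x y → y ≤ n
  unit : ∀ {x}, x < n → F x (x + 1)
  overlap : ∀ {x y z w}, x < y → y < z → z < w → F x z → F y w →
    F x y ∧ F y z ∧ F z w ∧ F x w
  three : ∀ {x a b y}, F x a → F a b → F b y → F x y → F x b ∨ F a y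

/-- A cut of a family of intervals: a point that is interior to no member. -/
def IsCut (F : ℕ → ℕ → Prop) (c : ℕ) : Prop := ∀ x y, F x y → x < c → y ≤ c

open Classical in
/-- The number of blocks into which the cuts divide `[0, n)`. -/
noncomputable def numBlocks (n : ℕ) (F : ℕ → ℕ → Prop) : ℕ := Nat.count (IsCut F) n

theorem isCut_zero (F : ℕ → ℕ → Prop) : IsCut F 0 := fun _ _ _ h => absurd h (Nat.not_lt_zero _)

theorem IsForest.isCut_of_le {n : ℕ} {F : ℕ → ℕ → Prop} (h : IsForest n F) {c : ℕ} (hc : n ≤ c) :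
    IsCut F c := fun _ _ hxy _ => (h.le hxy).trans hc

/-- The interval between two consecutive cuts is a member. -/
theorem IsForest.block {n : ℕ} {F : ℕ → ℕ → Prop} (h : IsForest n F) {c d : ℕ} (hcd : c < d)
    (hd : d ≤ n) (hc : IsCut F c) (hd' : IsCut F d) (hno : ∀ e, c < e → e < d → ¬ IsCut F e) :
    F c d := by
  classical
  have h1 : F c (c + 1) := h.unit (by omega)
  -- Take the longest member `[c, y)` inside `[c, d)`. If `y < d`, then `y` is not a cut, and a
  -- member crossing `y` merges with `[c, y)` into a longer one.
  obtain ⟨y, hyd, hy, hmax⟩ : ∃ y, y ≤ d ∧ F c y ∧ ∀ z, y < z → z ≤ d → ¬ F c z := by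
    refine ⟨Nat.findGreatest (F c) d, Nat.findGreatest_le d,
      Nat.findGreatest_spec (P := F c) (m := c + 1) (by omega) h1, fun z hz hzd => ?_⟩
    exact Nat.findGreatest_is_greatest hz hzd
  rcases hyd.lt_or_eq with hlt | rfl
  · exfalso
    have hcy := h.lt hy
    have := hno y hcy hlt
    simp only [IsCut, not_forall, not_le] at this
    obtain ⟨p, q, hpq, hpy, hyq⟩ := this
    have hqd : q ≤ d := hd' p q hpq (by omega)
    have hcp : c ≤ p := by
      by_contra hlt'
      have := hc p q hpq (by omega)
      omega
    rcases hcp.eq_or_lt with rfl | hcp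
    · exact hmax q hyq hqd hpq
    · exact hmax q hyq hqd (h.overlap hcp hpy hyq hy hpq).2.2.2
  · exact hy

/-! ### Cutting and gluing forests. -/

/-- Two families of intervals side by side, the first one on `[0, a)`. -/
def glue (a : ℕ) (A B : ℕ → ℕ → Prop) : ℕ → ℕ → Prop :=
  fun x y => A x y ∨ (a ≤ x ∧ B (x - a) (y - a))

/-- The members inside `[a, b)`, translated to start at `0`. -/
def restr (a b : ℕ) (F : ℕ → ℕ → Prop) : ℕ → ℕ → Prop :=
  fun x y => y + a ≤ b ∧ F (x + a) (y + a)

theorem IsForest.restr {n : ℕ} {F : ℕ → ℕ → Prop} (h : IsForest n F) {a b : ℕ} (hb : b ≤ n) :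
    IsForest (b - a) (restr a b F) where
  lt hxy := by have := h.lt hxy.2; omega
  le hxy := by have := hxy.1; omega
  unit {x} hx := ⟨by omega, by have := h.unit (x := x + a) (by omega); rwa [add_right_comm] at this⟩
  overlap {x y z w} h1 h2 h3 h4 h5 := by
    obtain ⟨e1, e2, e3, e4⟩ := h.overlap (x := x + a) (y := y + a) (z := z + a) (w := w + a)
      (by omega) (by omega) (by omega) h4.2 h5.2
    have := h4.1
    have := h5.1
    exact ⟨⟨by omega, e1⟩, ⟨by omega, e2⟩, ⟨by omega, e3⟩, ⟨by omega, e4⟩⟩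
  three {x c d y} h1 h2 h3 h4 := by
    have := h4.1
    have := h3.1
    have := h.lt h3.2
    rcases h.three h1.2 h2.2 h3.2 h4.2 with e | e
    · exact Or.inl ⟨by omega, e⟩
    · exact Or.inr ⟨by omega, e⟩

/-- No member straddles `a`, so two overlapping members, or a member and its three pieces, lie on
the same side of `a`. -/
theorem IsForest.glue {a b : ℕ} {A B : ℕ → ℕ → Prop} (hA : IsForest a A) (hB : IsForest b B) :
    IsForest (a + b) (glue a A B) where
  lt := by
    rintro x y (h | ⟨h1, h⟩)
    · exact hA.lt h
    · have := hB.lt h; omega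
  le := by
    rintro x y (h | ⟨h1, h⟩)
    · have := hA.le h; omega
    · have := hB.le h; omega
  unit := by
    intro x hx
    by_cases hxa : x < a
    · exact Or.inl (hA.unit hxa)
    · refine Or.inr ⟨by omega, ?_⟩
      have := hB.unit (x := x - a) (by omega)
      rwa [show x - a + 1 = x + 1 - a by omega] at this
  overlap := by
    rintro x y z w h1 h2 h3 (h | ⟨h4, h⟩) (h' | ⟨h5, h'⟩)
    · obtain ⟨e1, e2, e3, e4⟩ := hA.overlap h1 h2 h3 h h'
      exact ⟨Or.inl e1, Or.inl e2, Or.inl e3, Or.inl e4⟩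
    · have := hA.le h; omega
    · have := hA.le h'; omega
    · obtain ⟨e1, e2, e3, e4⟩ := hB.overlap (by omega) (by omega) (by omega) h h'
      exact ⟨Or.inr ⟨by omega, e1⟩, Or.inr ⟨by omega, e2⟩, Or.inr ⟨by omega, e3⟩,
        Or.inr ⟨by omega, e4⟩⟩
  three := by
    rintro x c d y (h1 | ⟨k1, h1⟩) h2 h3 (h4 | ⟨k4, h4⟩)
    · have := hA.le h4
      have l1 := hA.lt h1
      have l3 : d < y := by
        rcases h3 with h3 | ⟨k3, h3⟩
        · exact hA.lt h3
        · have := hB.lt h3; omega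
      have h2' : A c d := by
        rcases h2 with h2 | ⟨k2, h2⟩
        · exact h2
        · have := hB.lt h2; omega
      have h3' : A d y := by
        rcases h3 with h3 | ⟨k2, h3⟩
        · exact h3
        · omega
      exact (hA.three h1 h2' h3' h4).imp Or.inl Or.inl
    · have := hA.lt h1; have := hA.le h1; omega
    · have := hA.le h4
      have := hA.lt h4
      omega
    · have l1 := hB.lt h1
      have h2' : B (c - a) (d - a) := by
        rcases h2 with h2 | ⟨k2, h2⟩
        · have := hA.lt h2; have := hA.le h2; omega
        · exact h2
      have l2 := hB.lt h2'
      have h3' : B (d - a) (y - a) := by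
        rcases h3 with h3 | ⟨k2, h3⟩
        · have := hA.lt h3; have := hA.le h3; omega
        · exact h3
      exact (hB.three h1 h2' h3' h4).imp (fun e => Or.inr ⟨by omega, e⟩)
        (fun e => Or.inr ⟨by omega, e⟩)

theorem restr_glue_left {a b : ℕ} {A B : ℕ → ℕ → Prop} (hA : IsForest a A) (hB : IsForest b B) :
    restr 0 a (glue a A B) = A := by
  funext x y
  refine propext ⟨?_, fun h => ⟨hA.le h, Or.inl h⟩⟩
  rintro ⟨h1, h2 | ⟨h3, h2⟩⟩
  · exact h2
  · have := hB.lt h2; omega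

theorem restr_glue_right {a b : ℕ} {A B : ℕ → ℕ → Prop} (hA : IsForest a A) (hB : IsForest b B) :
    restr a (a + b) (glue a A B) = B := by
  funext x y
  refine propext ⟨?_, fun h => ⟨by have := hB.le h; omega, Or.inr ⟨by omega, by simpa using h⟩⟩⟩
  rintro ⟨h1, h2 | ⟨h3, h2⟩⟩
  · have := hA.lt h2; have := hA.le h2; omega
  · simpa using h2

theorem IsForest.glue_restr {a b : ℕ} {F : ℕ → ℕ → Prop} (h : IsForest (a + b) F)
    (ha : IsCut F a) : _root_.glue a (_root_.restr 0 a F) (_root_.restr a (a + b) F) = F := by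
  funext x y
  refine propext ⟨?_, fun hF => ?_⟩
  · rintro (⟨-, h1⟩ | ⟨h1, h2, h3⟩)
    · exact h1
    · have := h.lt h3
      rwa [show x - a + a = x by omega, show y - a + a = y by omega] at h3
  · have := h.lt hF
    have := h.le hF
    by_cases hxa : x < a
    · exact Or.inl ⟨ha _ _ hF hxa, hF⟩
    · exact Or.inr ⟨by omega, by omega,
        by rwa [show x - a + a = x by omega, show y - a + a = y by omega]⟩

theorem IsForest.isCut_restr {a b c : ℕ} {F : ℕ → ℕ → Prop} (h : IsForest (a + b) F)
    (ha : IsCut F a) : IsCut (_root_.restr a (a + b) F) c ↔ IsCut F (a + c) := by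
  constructor
  · intro hc x y hF hx
    have := h.le hF
    have := h.lt hF
    by_cases hxa : x < a
    · have := ha _ _ hF hxa; omega
    · have := hc (x - a) (y - a) ⟨by omega,
        by rwa [show x - a + a = x by omega, show y - a + a = y by omega]⟩ (by omega)
      omega
  · rintro hc x y ⟨h1, h2⟩ hx
    have := hc _ _ h2 (by omega)
    omega

/-- Each block is counted by its left end: `0` is always a cut, the right end is not counted, and
the full member excludes all other cuts. -/
theorem numBlocks_of_full {a : ℕ} {F : ℕ → ℕ → Prop} (ha : 0 < a) (h0 : F 0 a) :
    numBlocks a F = 1 := by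
  classical
  obtain ⟨a, rfl⟩ : ∃ k, a = 1 + k := ⟨a - 1, by omega⟩
  rw [numBlocks, Nat.count_add]
  have : Nat.count (fun k => IsCut F (1 + k)) a = 0 := by
    rw [Nat.count_iff_forall_not]
    intro k hk hc
    have := hc _ _ h0 (by omega)
    omega
  rw [this, add_zero, Nat.count_succ]
  simp [isCut_zero]

theorem numBlocks_glue {a b : ℕ} {F : ℕ → ℕ → Prop} (h : IsForest (a + b) F)
    (ha : IsCut F a) (h0 : F 0 a) :
    numBlocks (a + b) F = numBlocks b (restr a (a + b) F) + 1 := by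
  classical
  have h1 := numBlocks_of_full (h.lt h0) h0
  rw [numBlocks] at *
  rw [Nat.count_add, h1, add_comm, numBlocks]
  congr 2
  funext k
  exact propext (h.isCut_restr ha).symm

theorem IsForest.numBlocks_eq_one_iff {n : ℕ} {F : ℕ → ℕ → Prop} (h : IsForest n F) :
    numBlocks n F = 1 ↔ F 0 n := by
  classical
  refine ⟨fun h1 => ?_, fun h1 => numBlocks_of_full (h.lt h1) h1⟩
  rcases Nat.eq_zero_or_pos n with rfl | hn
  · simp [numBlocks] at h1
  refine h.block hn le_rfl (isCut_zero F) (h.isCut_of_le le_rfl) fun e he hen hc => ?_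
  rw [numBlocks, Nat.count_eq_card_filter_range, Finset.card_eq_one] at h1
  obtain ⟨u, hu⟩ := h1
  have m0 : 0 ∈ ({u} : Finset ℕ) := by rw [← hu]; simp [hn, isCut_zero]
  have m1 : e ∈ ({u} : Finset ℕ) := by rw [← hu]; simp [hen, hc]
  simp at m0 m1
  omega

theorem two_le_numBlocks_iff {n : ℕ} {F : ℕ → ℕ → Prop} :
    2 ≤ numBlocks n F ↔ ∃ c, 0 < c ∧ c < n ∧ IsCut F c := by
  classical
  rw [numBlocks, Nat.count_eq_card_filter_range]
  constructor
  · intro h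
    obtain ⟨u, hu, v, hv, huv⟩ := Finset.one_lt_card.1 (show 1 < _ from h)
    simp only [Finset.mem_filter, Finset.mem_range] at hu hv
    rcases Nat.eq_zero_or_pos u with rfl | hu0
    · exact ⟨v, by omega, hv⟩
    · exact ⟨u, hu0, hu⟩
  · rintro ⟨c, h0, hc, hcut⟩
    refine Finset.one_lt_card.2 ⟨0, ?_, c, ?_, by omega⟩
    · simp [isCut_zero]; omega
    · simp [hc, hcut]

/-- Two or three blocks have one or two interior cuts; `a = b` encodes a single cut, so that both
cases are treated together. -/
theorem exists_interior_cuts_subset {n : ℕ} {F : ℕ → ℕ → Prop} (h : numBlocks n F < 4)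
    (hn : 2 ≤ numBlocks n F) :
    ∃ a b, 0 < a ∧ a ≤ b ∧ b < n ∧ IsCut F a ∧ IsCut F b ∧
      ∀ e, 0 < e → e < n → IsCut F e → e = a ∨ e = b := by
  classical
  obtain ⟨c, h0, hc, hcut⟩ := two_le_numBlocks_iff.1 hn
  rw [numBlocks, Nat.count_eq_card_filter_range] at h
  set S := (Finset.range n).filter (IsCut F) with hS
  have hmem : ∀ e, e ∈ S ↔ e < n ∧ IsCut F e := fun e => by simp [hS]
  have m0 : 0 ∈ S := (hmem 0).2 ⟨by omega, isCut_zero F⟩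
  have mc : c ∈ S.erase 0 := Finset.mem_erase.2 ⟨by omega, (hmem c).2 ⟨hc, hcut⟩⟩
  have hcard : ((S.erase 0).erase c).card ≤ 1 := by
    rw [Finset.card_erase_of_mem mc, Finset.card_erase_of_mem m0]; omega
  by_cases hex : ∃ d, 0 < d ∧ d < n ∧ IsCut F d ∧ d ≠ c
  · obtain ⟨d, d0, dn, dcut, hdc⟩ := hex
    have key : ∀ e, 0 < e → e < n → IsCut F e → e = c ∨ e = d := by
      intro e e0 en ecut
      by_contra! hcon
      exact hcon.2 (Finset.card_le_one.1 hcard e (by simp [hmem]; grind) d (by simp [hmem]; grind))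
    rcases le_total c d with hle | hle
    · exact ⟨c, d, h0, hle, dn, hcut, dcut, key⟩
    · exact ⟨d, c, d0, hle, hc, dcut, hcut, fun e h1 h2 h3 => (key e h1 h2 h3).symm⟩
  · push Not at hex
    exact ⟨c, c, h0, le_rfl, hc, hcut, hcut, fun e h1 h2 h3 => Or.inl (hex e h1 h2 h3)⟩

theorem four_le_numBlocks_ne {n : ℕ} {F : ℕ → ℕ → Prop} (h : 4 ≤ numBlocks n F) (a b : ℕ) :
    ∃ c, 0 < c ∧ c < n ∧ IsCut F c ∧ c ≠ a ∧ c ≠ b := by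
  classical
  by_contra! hcon
  rw [numBlocks, Nat.count_eq_card_filter_range] at h
  refine absurd h (not_le.2 (lt_of_le_of_lt (Finset.card_le_card (t := {0, a, b}) fun e he => ?_)
    (lt_of_le_of_lt Finset.card_le_three (by norm_num))))
  simp only [Finset.mem_filter, Finset.mem_range] at he
  simp only [Finset.mem_insert, Finset.mem_singleton]
  by_contra! h3
  exact h3.2.2 (hcon e (by omega) he.1 he.2 h3.2.1)

/-! ### Linear and prime roots: removing and restoring the root. -/

/-- `F` has a member `[0, c)` whose complement `[c, n)` is a member as well. -/
def HasLinearCut (n : ℕ) (F : ℕ → ℕ → Prop) : Prop := ∃ c, F 0 c ∧ F c n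

/-- Add the whole interval. -/
def primeTop (n : ℕ) (G : ℕ → ℕ → Prop) : ℕ → ℕ → Prop := fun x y => G x y ∨ (x = 0 ∧ y = n)

/-- Remove the whole interval. -/
def removePrimeTop (n : ℕ) (F : ℕ → ℕ → Prop) : ℕ → ℕ → Prop :=
  fun x y => F x y ∧ ¬ (x = 0 ∧ y = n)

/-- Add all the unions of consecutive blocks. -/
def linearTop (n : ℕ) (G : ℕ → ℕ → Prop) : ℕ → ℕ → Prop :=
  fun x y => G x y ∨ (x < y ∧ y ≤ n ∧ IsCut G x ∧ IsCut G y)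

/-- Remove the members that are unions of at least two blocks of a linear family. -/
def removeLinearTop (n : ℕ) (F : ℕ → ℕ → Prop) : ℕ → ℕ → Prop :=
  fun x y => F x y ∧ ∀ c, x < c → c < y → ¬ (F 0 c ∧ F c n)

theorem IsForest.not_full_of_cut {n c : ℕ} {G : ℕ → ℕ → Prop} (hG : IsCut G c)
    (h0 : 0 < c) (hc : c < n) : ¬ G 0 n := fun h => by
  have := hG _ _ h h0
  omega

/-- Only the union of overlapping members could be the removed interval. Then these are `[0, z)` and
`[y, n)`, and their difference `[0, y)` makes `y` a linear cut. -/
theorem IsForest.removePrimeTop {n : ℕ} {F : ℕ → ℕ → Prop} (h : IsForest n F) (hn : 2 ≤ n)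
    (hlin : ¬ HasLinearCut n F) : IsForest n (removePrimeTop n F) where
  lt hxy := h.lt hxy.1
  le hxy := h.le hxy.1
  unit hx := ⟨h.unit hx, by omega⟩
  overlap {x y z w} h1 h2 h3 h4 h5 := by
    obtain ⟨e1, e2, e3, e4⟩ := h.overlap h1 h2 h3 h4.1 h5.1
    have := h.le h5.1
    refine ⟨⟨e1, by omega⟩, ⟨e2, by omega⟩, ⟨e3, by omega⟩, ⟨e4, ?_⟩⟩
    rintro ⟨rfl, rfl⟩
    exact hlin ⟨y, e1, h5.1⟩
  three {x a b y} h1 h2 h3 h4 := by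
    have := h.lt h1.1
    have := h.lt h3.1
    have := h.le h3.1
    exact (h.three h1.1 h2.1 h3.1 h4.1).imp (fun e => ⟨e, by omega⟩) (fun e => ⟨e, by omega⟩)

/-- A single block would be the removed interval, and two blocks give a linear cut. With three
blocks the axiom `three` unites two neighbours, which again gives a linear cut. -/
theorem IsForest.four_le_numBlocks_removePrimeTop {n : ℕ} {F : ℕ → ℕ → Prop} (h : IsForest n F)
    (hn : 2 ≤ n) (h0 : F 0 n) (hlin : ¬ HasLinearCut n F) :
    4 ≤ numBlocks n (_root_.removePrimeTop n F) := by
  have hG := h.removePrimeTop hn hlin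
  by_contra! hlt
  have h2 : 2 ≤ numBlocks n (_root_.removePrimeTop n F) := by
    by_contra! hlt2
    exact (hG.block (by omega) le_rfl (isCut_zero _) (hG.isCut_of_le le_rfl) fun e h1 h2 h3 =>
      absurd (two_le_numBlocks_iff.2 ⟨e, h1, h2, h3⟩) (by omega)).2 ⟨rfl, rfl⟩
  obtain ⟨a, b, ha, hab, hb, hca, hcb, hall⟩ := exists_interior_cuts_subset hlt h2
  have e1 := hG.block ha (by omega) (isCut_zero _) hca fun e h1 h2 h3 => by
    have := hall e h1 (by omega) h3; omega
  have e3 := hG.block hb le_rfl hcb (hG.isCut_of_le le_rfl) fun e h1 h2 h3 => by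
    have := hall e (by omega) h2 h3; omega
  rcases hab.eq_or_lt with rfl | hab
  · exact hlin ⟨a, e1.1, e3.1⟩
  · have e2 := hG.block hab (by omega) hca hcb fun e h1 h2 h3 => by
      have := hall e (by omega) (by omega) h3; omega
    rcases h.three e1.1 e2.1 e3.1 h0 with e | e
    · exact hlin ⟨b, e, e3.1⟩
    · exact hlin ⟨a, e1.1, e⟩

/-- The whole interval overlaps nothing properly. It does not split into three members either: with
four blocks some interior cut differs from both splitting points and would be interior to a piece.
-/
theorem IsForest.primeTop {n : ℕ} {G : ℕ → ℕ → Prop} (h : IsForest n G)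
    (h4 : 4 ≤ numBlocks n G) : IsForest n (primeTop n G) := by
  obtain ⟨c, c0, cn, -⟩ := four_le_numBlocks_ne h4 0 0
  refine ⟨?_, ?_, fun hx => Or.inl (h.unit hx), ?_, ?_⟩
  · rintro x y (e | ⟨rfl, rfl⟩)
    · exact h.lt e
    · omega
  · rintro x y (e | ⟨rfl, rfl⟩)
    · exact h.le e
    · omega
  · rintro x y z w h1 h2 h3 (e | ⟨rfl, rfl⟩) (e' | ⟨rfl, rfl⟩)
    · obtain ⟨e1, e2, e3, e4⟩ := h.overlap h1 h2 h3 e e'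
      exact ⟨Or.inl e1, Or.inl e2, Or.inl e3, Or.inl e4⟩
    · omega
    · have := h.le e'; omega
    · omega
  · rintro x a b y (e1 | e1) (e2 | e2) (e3 | e3) (e4 | ⟨rfl, rfl⟩) <;>
      try have := h.lt e1
    all_goals try have := h.lt e2
    all_goals try have := h.lt e3
    all_goals try have := h.le e3
    all_goals try have := h.le e2
    all_goals try have := h.lt e4
    all_goals try omega
    · exact (h.three e1 e2 e3 e4).imp Or.inl Or.inl
    · obtain ⟨d, d0, dn, hd, hda, hdb⟩ := four_le_numBlocks_ne h4 a b
      have := hd _ _ e1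
      have := hd _ _ e2
      have := hd _ _ e3
      omega

theorem IsForest.not_hasLinearCut_primeTop {n : ℕ} {G : ℕ → ℕ → Prop} (h : IsForest n G)
    (h4 : 4 ≤ numBlocks n G) : ¬ HasLinearCut n (_root_.primeTop n G) := by
  have hF := h.primeTop h4
  rintro ⟨c, h1, h2⟩
  have := hF.lt h1
  have := hF.lt h2
  have e1 : G 0 c := h1.resolve_right (by omega)
  have e2 : G c n := h2.resolve_right (by omega)
  obtain ⟨d, d0, dn, hd, hda, -⟩ := four_le_numBlocks_ne h4 c c
  have := hd _ _ e1
  have := hd _ _ e2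
  omega

theorem removePrimeTop_primeTop {n : ℕ} {G : ℕ → ℕ → Prop} (h : 2 ≤ numBlocks n G) :
    removePrimeTop n (primeTop n G) = G := by
  obtain ⟨c, c0, cn, hc⟩ := two_le_numBlocks_iff.1 h
  have := IsForest.not_full_of_cut hc c0 cn
  funext x y
  simp only [removePrimeTop, primeTop, eq_iff_iff]
  grind

theorem primeTop_removePrimeTop {n : ℕ} {F : ℕ → ℕ → Prop} (h : F 0 n) :
    primeTop n (removePrimeTop n F) = F := by
  funext x y
  simp only [removePrimeTop, primeTop, eq_iff_iff]
  grind

/-- A linear cut interior to an interval produced by an axiom is already interior to one of the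
given members. -/
theorem IsForest.removeLinearTop {n : ℕ} {F : ℕ → ℕ → Prop} (h : IsForest n F) :
    IsForest n (removeLinearTop n F) where
  lt hxy := h.lt hxy.1
  le hxy := h.le hxy.1
  unit hx := ⟨h.unit hx, by omega⟩
  overlap {x y z w} h1 h2 h3 h4 h5 := by
    obtain ⟨e1, e2, e3, e4⟩ := h.overlap h1 h2 h3 h4.1 h5.1
    refine ⟨⟨e1, fun c c1 c2 => h4.2 c (by omega) (by omega)⟩,
      ⟨e2, fun c c1 c2 => h4.2 c (by omega) (by omega)⟩,
      ⟨e3, fun c c1 c2 => h5.2 c (by omega) (by omega)⟩, ⟨e4, fun c c1 c2 => ?_⟩⟩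
    by_cases hcz : c < z
    · exact h4.2 c (by omega) (by omega)
    · exact h5.2 c (by omega) (by omega)
  three {x a b y} h1 h2 h3 h4 := by
    have := h.lt h1.1
    have := h.lt h3.1
    exact (h.three h1.1 h2.1 h3.1 h4.1).imp
      (fun e => ⟨e, fun c c1 c2 => h4.2 c (by omega) (by omega)⟩)
      (fun e => ⟨e, fun c c1 c2 => h4.2 c (by omega) (by omega)⟩)

/-- Unless it shares an end with `[0, n)`, the member `[x, y)` overlaps both `[0, c)` and `[c, n)`;
the differences and unions provide the linear cuts. -/
theorem IsForest.linearCut_of_crossing {n x y c : ℕ} {F : ℕ → ℕ → Prop} (h : IsForest n F)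
    (hF : F x y) (hxc : x < c) (hcy : c < y) (h0 : F 0 c) (h1 : F c n) :
    (x = 0 ∨ (F 0 x ∧ F x n)) ∧ (y = n ∨ (F 0 y ∧ F y n)) := by
  have := h.le hF
  have key : 0 < x → F 0 x ∧ F 0 y := fun hx =>
    ⟨(h.overlap hx hxc hcy h0 hF).1, (h.overlap hx hxc hcy h0 hF).2.2.2⟩
  have key' : y < n → F y n ∧ F x n := fun hy =>
    ⟨(h.overlap hxc hcy hy hF h1).2.2.1, (h.overlap hxc hcy hy hF h1).2.2.2⟩
  constructor
  · rcases Nat.eq_zero_or_pos x with hx | hx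
    · exact Or.inl hx
    · refine Or.inr ⟨(key hx).1, ?_⟩
      rcases (h.le hF).eq_or_lt with rfl | hy
      · exact hF
      · exact (key' hy).2
  · rcases (h.le hF).eq_or_lt with hy | hy
    · exact Or.inl hy
    · refine Or.inr ⟨?_, (key' hy).1⟩
      rcases Nat.eq_zero_or_pos x with rfl | hx
      · exact hF
      · exact (key hx).2

/-- For interior cuts, `[x, y)` is the intersection of the overlapping members `[0, y)` and `[x,
n)`. -/
theorem IsForest.mem_of_linearCuts {n x y : ℕ} {F : ℕ → ℕ → Prop} (h : IsForest n F)
    (h0 : F 0 n) (hxy : x < y) (hx : x = 0 ∨ (F 0 x ∧ F x n)) (hy : y = n ∨ (F 0 y ∧ F y n)) :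
    F x y := by
  rcases hx with rfl | hx
  · rcases hy with rfl | hy
    · exact h0
    · exact hy.1
  · rcases hy with rfl | hy
    · exact hx.2
    · exact (h.overlap (h.lt hx.1) hxy (h.lt hy.2) hy.1 hx.2).2.1

/-- The cuts that remain after removing the unions of blocks are the linear cuts. -/
theorem IsForest.isCut_removeLinearTop {n c : ℕ} {F : ℕ → ℕ → Prop} (h : IsForest n F)
    (h0 : F 0 n) (hc0 : 0 < c) (hcn : c < n) :
    IsCut (_root_.removeLinearTop n F) c ↔ F 0 c ∧ F c n := by
  classical
  constructor
  · intro hc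
    by_contra hnot
    -- If `c` is not a linear cut, let `l < c < r` be the nearest linear cuts, with `0` and `n`
    -- admitted as sentinels. Then `[l, r)` is a member without interior linear cut, so it survives
    -- the removal and crosses `c`.
    set L : ℕ → Prop := fun e => e = 0 ∨ (F 0 e ∧ F e n) with hL
    set R : ℕ → Prop := fun e => c ≤ e ∧ (e = n ∨ (F 0 e ∧ F e n)) with hR
    have hLc : L (Nat.findGreatest L c) := Nat.findGreatest_spec (m := 0) (by omega) (Or.inl rfl)
    have hlc := Nat.findGreatest_le (P := L) c
    have hex : ∃ e, R e := ⟨n, hcn.le, Or.inl rfl⟩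
    have hRc := Nat.find_spec hex
    set l := Nat.findGreatest L c with hl
    set r := Nat.find hex with hr
    have hl' : l < c := by
      rcases hlc.lt_or_eq with e | e
      · exact e
      · rw [e] at hLc
        exact absurd (hLc.resolve_left (by omega)) hnot
    have hr' : c < r := by
      rcases hRc.1.lt_or_eq with e | e
      · exact e
      · rw [← e] at hRc
        exact absurd (hRc.2.resolve_left (by omega)) hnot
    have := hc l r ⟨h.mem_of_linearCuts h0 (by omega) hLc hRc.2, fun d d1 d2 d3 => ?_⟩ hl'
    · omega
    · by_cases hdc : d ≤ c
      · exact Nat.findGreatest_is_greatest d1 hdc (Or.inr d3)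
      · exact Nat.find_min hex d2 ⟨by omega, Or.inr d3⟩
  · rintro hc x y ⟨-, hF⟩ hx
    by_contra! hy
    exact hF c hx hy hc

theorem linearTop_removeLinearTop {n : ℕ} {F : ℕ → ℕ → Prop} (h : IsForest n F) (h0 : F 0 n) :
    linearTop n (removeLinearTop n F) = F := by
  have hG := h.removeLinearTop
  funext x y
  refine propext ⟨?_, fun hF => ?_⟩
  · rintro (e | ⟨hxy, hyn, hx, hy⟩)
    · exact e.1
    · refine h.mem_of_linearCuts h0 hxy ?_ ?_
      · rcases Nat.eq_zero_or_pos x with hx0 | hx0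
        · exact Or.inl hx0
        · exact Or.inr ((h.isCut_removeLinearTop h0 hx0 (by omega)).1 hx)
      · rcases hyn.eq_or_lt with hx0 | hx0
        · exact Or.inl hx0
        · exact Or.inr ((h.isCut_removeLinearTop h0 (by omega) hx0).1 hy)
  · by_cases hc : ∃ c, x < c ∧ c < y ∧ F 0 c ∧ F c n
    · obtain ⟨c, hxc, hcy, h1, h2⟩ := hc
      obtain ⟨hx, hy⟩ := h.linearCut_of_crossing hF hxc hcy h1 h2
      refine Or.inr ⟨h.lt hF, h.le hF, ?_, ?_⟩
      · rcases hx with rfl | hx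
        · exact isCut_zero _
        · exact (h.isCut_removeLinearTop h0 (h.lt hx.1) (h.lt hx.2)).2 hx
      · rcases hy with rfl | hy
        · exact hG.isCut_of_le le_rfl
        · exact (h.isCut_removeLinearTop h0 (h.lt hy.1) (h.lt hy.2)).2 hy
    · push Not at hc
      exact Or.inl ⟨hF, fun c c1 c2 c3 => hc c c1 c2 c3.1 c3.2⟩

theorem IsForest.two_le_numBlocks_removeLinearTop {n : ℕ} {F : ℕ → ℕ → Prop} (h : IsForest n F)
    (h0 : F 0 n) (hlin : HasLinearCut n F) : 2 ≤ numBlocks n (_root_.removeLinearTop n F) := by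
  obtain ⟨c, h1, h2⟩ := hlin
  exact two_le_numBlocks_iff.2 ⟨c, h.lt h1, h.lt h2,
    (h.isCut_removeLinearTop h0 (h.lt h1) (h.lt h2)).2 ⟨h1, h2⟩⟩

theorem IsForest.linearTop {n : ℕ} {G : ℕ → ℕ → Prop} (h : IsForest n G) :
    IsForest n (linearTop n G) := by
  have hlt : ∀ {x y}, _root_.linearTop n G x y → x < y := by
    rintro x y (e | ⟨e, -⟩)
    · exact h.lt e
    · exact e
  refine ⟨hlt, ?_, fun hx => Or.inl (h.unit hx), ?_, ?_⟩
  · rintro x y (e | ⟨-, e, -⟩)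
    · exact h.le e
    · exact e
  · rintro x y z w h1 h2 h3 (e | ⟨g1, g2, g3, g4⟩) (e' | ⟨g1', g2', g3', g4'⟩)
    · obtain ⟨e1, e2, e3, e4⟩ := h.overlap h1 h2 h3 e e'
      exact ⟨Or.inl e1, Or.inl e2, Or.inl e3, Or.inl e4⟩
    · have := g3' _ _ e h1; omega
    · have := g4 _ _ e' h2; omega
    · exact ⟨Or.inr ⟨h1, by omega, g3, g3'⟩, Or.inr ⟨h2, g2, g3', g4⟩,
        Or.inr ⟨h3, g2', g4, g4'⟩, Or.inr ⟨by omega, g2', g3, g4'⟩⟩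
  · intro x a b y h1 h2 h3 h4
    have l1 := hlt h1
    have l2 := hlt h2
    have l3 := hlt h3
    have hyn : y ≤ n := by
      rcases h4 with e | ⟨-, e, -⟩
      · exact h.le e
      · exact e
    by_cases hg : G x y
    · have e1 : G x a := h1.resolve_right fun e => by have := e.2.2.2 _ _ hg l1; omega
      have e2 : G a b := h2.resolve_right fun e => by have := e.2.2.1 _ _ hg l1; omega
      have e3 : G b y := h3.resolve_right fun e => by
        have := e.2.2.1 _ _ hg (l1.trans l2); omega
      exact (h.three e1 e2 e3 hg).imp Or.inl Or.inl
    · obtain ⟨-, -, cx, cy⟩ := h4.resolve_left hg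
      by_cases ca : IsCut G a
      · exact Or.inr (Or.inr ⟨by omega, hyn, ca, cy⟩)
      by_cases cb : IsCut G b
      · exact Or.inl (Or.inr ⟨by omega, by omega, cx, cb⟩)
      have e1 : G x a := h1.resolve_right fun e => ca e.2.2.2
      have e2 : G a b := h2.resolve_right fun e => ca e.2.2.1
      have e3 : G b y := h3.resolve_right fun e => cb e.2.2.1
      simp only [IsCut, not_forall, not_le] at ca cb
      obtain ⟨p, q, hpq, hpa, haq⟩ := ca
      obtain ⟨p', q', hpq', hpb, hbq⟩ := cb
      have hxp : x ≤ p := by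
        by_contra! hlt'
        have := cx _ _ hpq hlt'; omega
      have hq'y : q' ≤ y := cy _ _ hpq' (by omega)
      have hqy : q ≤ y := cy _ _ hpq (by omega)
      -- Neither `a` nor `b` is a cut. A member crossing `a` fuses with `[x, a)` into `[x, q)` with
      -- `a < q`; according to the place of `q` relative to `b`, this yields `[x, b)` or the
      -- excluded `[x, y)`.
      have hxq : G x q := by
        rcases hxp.eq_or_lt with rfl | hlt'
        · exact hpq
        · exact (h.overlap hlt' hpa haq e1 hpq).2.2.2
      rcases lt_trichotomy q b with hqb | rfl | hqb
      · exact Or.inl (Or.inl (h.overlap l1 haq hqb hxq e2).2.2.2)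
      · exact Or.inl (Or.inl hxq)
      · exfalso
        rcases hqy.eq_or_lt with rfl | hlt'
        · exact hg hxq
        · exact hg (h.overlap (l1.trans l2) hqb hlt' hxq e3).2.2.2

theorem linearTop_full {n : ℕ} {G : ℕ → ℕ → Prop} (h : IsForest n G) (hn : 0 < n) :
    linearTop n G 0 n := Or.inr ⟨hn, le_rfl, isCut_zero _, h.isCut_of_le le_rfl⟩

theorem IsForest.linearCut_linearTop_iff {n c : ℕ} {G : ℕ → ℕ → Prop} (h : IsForest n G)
    (hG : 2 ≤ numBlocks n G) (hc0 : 0 < c) (hcn : c < n) :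
    (_root_.linearTop n G 0 c ∧ _root_.linearTop n G c n) ↔ IsCut G c := by
  constructor
  · rintro ⟨e1 | e1, e2 | e2⟩
    -- If `[0, c)` and `[c, n)` both come from `G`, an interior cut of `G` can only be `c`.
    · obtain ⟨d, d0, dn, hd⟩ := two_le_numBlocks_iff.1 hG
      have := hd _ _ e1 d0
      have := hd _ _ e2
      obtain rfl : d = c := by omega
      exact hd
    · exact e2.2.2.1
    · exact e1.2.2.2
    · exact e1.2.2.2
  · intro hc
    exact ⟨Or.inr ⟨hc0, hcn.le, isCut_zero _, hc⟩,
      Or.inr ⟨hcn, le_rfl, hc, h.isCut_of_le le_rfl⟩⟩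

theorem IsForest.hasLinearCut_linearTop {n : ℕ} {G : ℕ → ℕ → Prop} (h : IsForest n G)
    (hG : 2 ≤ numBlocks n G) : HasLinearCut n (_root_.linearTop n G) := by
  obtain ⟨d, d0, dn, hd⟩ := two_le_numBlocks_iff.1 hG
  exact ⟨d, (h.linearCut_linearTop_iff hG d0 dn).2 hd⟩

theorem removeLinearTop_linearTop {n : ℕ} {G : ℕ → ℕ → Prop} (h : IsForest n G)
    (hG : 2 ≤ numBlocks n G) : removeLinearTop n (linearTop n G) = G := by
  funext x y
  refine propext ⟨?_, fun hxy => ⟨Or.inl hxy, fun c c1 c2 c3 => ?_⟩⟩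
  · rintro ⟨e | ⟨e1, e2, e3, e4⟩, hc⟩
    · exact e
    · exact h.block e1 e2 e3 e4 fun c c1 c2 c3 => hc c c1 c2
        ((h.linearCut_linearTop_iff hG (by omega) (by omega)).2 c3)
  · have := h.le hxy
    have := (h.linearCut_linearTop_iff hG (by omega) (by omega)).1 c3 _ _ hxy c1
    omega

/-! ### Counting forests and trees. -/

theorem finite_setOf_isForest (n : ℕ) : {F : ℕ → ℕ → Prop | IsForest n F}.Finite := by
  classical
  refine (((Finset.range (n + 1) ×ˢ Finset.range (n + 1)).powerset.finite_toSet).image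
    (fun (s : Finset (ℕ × ℕ)) x y => (x, y) ∈ s)).subset fun F hF => ?_
  refine ⟨(Finset.range (n + 1) ×ˢ Finset.range (n + 1)).filter fun p => F p.1 p.2,
    Finset.mem_coe.2 (Finset.mem_powerset.2 (Finset.filter_subset _ _)), ?_⟩
  funext x y
  simp only [Finset.mem_filter, Finset.mem_product, Finset.mem_range, eq_iff_iff,
    and_iff_right_iff_imp]
  intro h
  have := hF.lt h
  have := hF.le h
  omega

open Classical in
/-- The forests on `[0, n)` whose number of blocks satisfies `Q`. -/
noncomputable def forests (n : ℕ) (Q : ℕ → Prop) : Finset (ℕ → ℕ → Prop) :=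
  (finite_setOf_isForest n).toFinset.filter fun F => Q (numBlocks n F)

theorem mem_forests {n : ℕ} {Q : ℕ → Prop} {F : ℕ → ℕ → Prop} :
    F ∈ forests n Q ↔ IsForest n F ∧ Q (numBlocks n F) := by
  simp [forests]

theorem mem_forests_one {n : ℕ} {F : ℕ → ℕ → Prop} :
    F ∈ forests n (· = 1) ↔ IsForest n F ∧ F 0 n := by
  rw [mem_forests]
  exact and_congr_right fun h => h.numBlocks_eq_one_iff

/-- The first positive cut. -/
noncomputable def firstCut (F : ℕ → ℕ → Prop) : ℕ := sInf {a | 0 < a ∧ IsCut F a}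

theorem IsForest.firstCut_eq_iff {n a : ℕ} {F : ℕ → ℕ → Prop} (h : IsForest n F) (hn : 0 < n) :
    firstCut F = a ↔ F 0 a ∧ IsCut F a := by
  have hne : {a | 0 < a ∧ IsCut F a}.Nonempty := ⟨n, hn, h.isCut_of_le le_rfl⟩
  constructor
  · rintro rfl
    have hmem := Nat.sInf_mem hne
    refine ⟨h.block hmem.1 (Nat.sInf_le ⟨hn, h.isCut_of_le le_rfl⟩) (isCut_zero _) hmem.2
      fun e h1 h2 h3 => ?_, hmem.2⟩
    exact Nat.notMem_of_lt_sInf h2 ⟨h1, h3⟩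
  · rintro ⟨h1, h2⟩
    refine le_antisymm (Nat.sInf_le ⟨h.lt h1, h2⟩) ?_
    have hmem := Nat.sInf_mem hne
    exact hmem.2 _ _ h1 hmem.1

/-- Splitting at the first positive cut gives a tree and a forest with one block fewer. The
condition `1 ≤ k` guards the truncated `k - 1`. -/
theorem card_forests_fiber (a b : ℕ) (ha : 0 < a) (Q : ℕ → Prop)
    [DecidablePred fun F => firstCut F = a] :
    ((forests (a + b) fun k => 1 ≤ k ∧ Q (k - 1)).filter fun F => firstCut F = a).card =
      (forests a (· = 1)).card * (forests b Q).card := by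
  rw [← Finset.card_product]
  refine Finset.card_nbij' (fun F => (restr 0 a F, restr a (a + b) F))
    (fun p => glue a p.1 p.2) ?_ ?_ ?_ ?_
  · intro F hF
    simp only [Finset.coe_filter, Set.mem_ofPred_eq, mem_forests] at hF
    obtain ⟨⟨hF, -, hQ⟩, hcut⟩ := hF
    obtain ⟨h0, hcut⟩ := (hF.firstCut_eq_iff (by omega)).1 hcut
    have hr := hF.restr (a := a) le_rfl
    rw [Nat.add_sub_cancel_left] at hr
    refine Finset.mem_coe.2 (Finset.mem_product.2 ⟨mem_forests_one.2 ⟨hF.restr (a := 0)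
      (by omega), ⟨by omega, h0⟩⟩, mem_forests.2 ⟨hr, ?_⟩⟩)
    rwa [numBlocks_glue hF hcut h0, Nat.add_sub_cancel] at hQ
  · rintro ⟨A, B⟩ hp
    obtain ⟨hA, hB⟩ := Finset.mem_product.1 (Finset.mem_coe.1 hp)
    obtain ⟨hA, hA0⟩ := mem_forests_one.1 hA
    obtain ⟨hB, hQ⟩ := mem_forests.1 hB
    have hF := hA.glue hB
    have h0 : glue a A B 0 a := Or.inl hA0
    have hcut : IsCut (glue a A B) a := by
      rintro x y (e | ⟨e, -⟩) hx
      · exact hA.le e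
      · omega
    simp only [Finset.coe_filter, Set.mem_ofPred_eq, mem_forests]
    refine ⟨⟨hF, ?_⟩, (hF.firstCut_eq_iff (by omega)).2 ⟨h0, hcut⟩⟩
    rw [numBlocks_glue hF hcut h0, restr_glue_right hA hB]
    exact ⟨by omega, by simpa using hQ⟩
  · intro F hF
    simp only [Finset.coe_filter, Set.mem_ofPred_eq, mem_forests] at hF
    obtain ⟨⟨hF, -, hQ⟩, hcut⟩ := hF
    exact hF.glue_restr ((hF.firstCut_eq_iff (by omega)).1 hcut).2
  · rintro ⟨A, B⟩ hp
    obtain ⟨hA, hB⟩ := Finset.mem_product.1 (Finset.mem_coe.1 hp)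
    obtain ⟨hA, hA0⟩ := mem_forests_one.1 hA
    obtain ⟨hB, hQ⟩ := mem_forests.1 hB
    exact Prod.ext (restr_glue_left hA hB) (restr_glue_right hA hB)

theorem numBlocks_zero (F : ℕ → ℕ → Prop) : numBlocks 0 F = 0 := by simp [numBlocks]

theorem numBlocks_pos {n : ℕ} (hn : 0 < n) (F : ℕ → ℕ → Prop) : 0 < numBlocks n F := by
  classical
  rw [numBlocks, Nat.count_eq_card_filter_range]
  exact Finset.card_pos.2 ⟨0, by simp [hn, isCut_zero]⟩

theorem forests_zero_eq_empty {Q : ℕ → Prop} (hQ : ¬ Q 0) : forests 0 Q = ∅ := by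
  refine Finset.eq_empty_of_forall_notMem fun F hF => hQ ?_
  simpa [numBlocks_zero] using (mem_forests.1 hF).2

/-- Counting forests by their first block. -/
theorem card_forests_succ (n : ℕ) (Q : ℕ → Prop) :
    (forests n fun k => 1 ≤ k ∧ Q (k - 1)).card =
      ∑ p ∈ Finset.HasAntidiagonal.antidiagonal n,
        (forests p.1 (· = 1)).card * (forests p.2 Q).card := by
  classical
  rcases Nat.eq_zero_or_pos n with rfl | hn
  · rw [forests_zero_eq_empty (by simp)]
    simp [forests_zero_eq_empty (Q := (· = 1))]
  rw [Finset.card_eq_sum_card_fiberwise (f := fun F => (firstCut F, n - firstCut F))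
    (t := Finset.HasAntidiagonal.antidiagonal n)]
  · refine Finset.sum_congr rfl ?_
    rintro ⟨a, b⟩ hab
    rw [Finset.HasAntidiagonal.mem_antidiagonal] at hab
    dsimp only at hab ⊢
    rcases Nat.eq_zero_or_pos a with rfl | ha
    · rw [forests_zero_eq_empty (Q := (· = 1)) (by simp), Finset.card_empty, zero_mul,
        Finset.card_eq_zero]
      refine Finset.eq_empty_of_forall_notMem fun F hF => ?_
      simp only [Finset.mem_filter, mem_forests, Prod.mk.injEq] at hF
      have := (hF.1.1.firstCut_eq_iff hn).1 hF.2.1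
      exact absurd (hF.1.1.lt this.1) (by omega)
    · subst hab
      rw [← card_forests_fiber a b ha Q]
      congr 1
      refine Finset.filter_congr fun F hF => ?_
      simp only [Prod.mk.injEq, and_iff_left_iff_imp]
      omega
  · intro F hF
    have hF := (mem_forests.1 (Finset.mem_coe.1 hF)).1
    have := hF.le ((hF.firstCut_eq_iff hn).1 rfl).1
    simp only [Finset.mem_coe, Finset.HasAntidiagonal.mem_antidiagonal]
    omega

theorem card_forests_congr {n : ℕ} {Q Q' : ℕ → Prop} (h : ∀ k, (0 < n → 0 < k) → (n = 0 → k = 0) →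
    (Q k ↔ Q' k)) : (forests n Q).card = (forests n Q').card := by
  congr 1
  ext F
  rw [mem_forests, mem_forests]
  exact and_congr_right fun _ => h _ (fun hn => numBlocks_pos hn F)
    (by rintro rfl; exact numBlocks_zero F)

theorem isForest_zero_iff {F : ℕ → ℕ → Prop} : IsForest 0 F ↔ F = fun _ _ => False := by
  constructor
  · intro h
    funext x y
    refine propext ⟨fun e => ?_, False.elim⟩
    have := h.lt e
    have := h.le e
    omega
  · rintro rfl
    exact ⟨by simp, by simp, by simp, by simp, by simp⟩

theorem card_forests_zero {Q : ℕ → Prop} (hQ : Q 0) : (forests 0 Q).card = 1 := by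
  rw [Finset.card_eq_one]
  refine ⟨fun _ _ => False, ?_⟩
  ext F
  simp [mem_forests, numBlocks_zero, hQ, isForest_zero_iff]

theorem isForest_one_iff {F : ℕ → ℕ → Prop} : IsForest 1 F ↔ F = fun x y => x = 0 ∧ y = 1 := by
  constructor
  · intro h
    funext x y
    refine propext ⟨fun e => ?_, ?_⟩
    · have := h.lt e
      have := h.le e
      omega
    · rintro ⟨rfl, rfl⟩
      exact h.unit one_pos
  · rintro rfl
    refine ⟨by omega, by omega, by omega, by omega, by omega⟩

theorem card_forests_one : (forests 1 (· = 1)).card = 1 := by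
  rw [Finset.card_eq_one]
  refine ⟨fun x y => x = 0 ∧ y = 1, ?_⟩
  ext F
  simp only [mem_forests_one, isForest_one_iff, Finset.mem_singleton, and_iff_left_iff_imp]
  rintro rfl
  simp

/-- Counting trees by the type of their root. -/
theorem card_trees {n : ℕ} (hn : 2 ≤ n) : (forests n (· = 1)).card =
    (forests n (2 ≤ ·)).card + (forests n (4 ≤ ·)).card := by
  classical
  -- The linear roots account for the forests with at least two blocks, the prime ones for those
  -- with at least four.
  rw [← Finset.card_filter_add_card_filter_not (s := forests n (· = 1)) (HasLinearCut n)]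
  congr 1
  · refine Finset.card_nbij' (removeLinearTop n) (linearTop n) ?_ ?_ ?_ ?_
    · intro F hF
      obtain ⟨hF, hl⟩ := Finset.mem_filter.1 (Finset.mem_coe.1 hF)
      obtain ⟨hF, h0⟩ := mem_forests_one.1 hF
      exact mem_forests.2 ⟨hF.removeLinearTop, hF.two_le_numBlocks_removeLinearTop h0 hl⟩
    · intro G hG
      obtain ⟨hG, h2⟩ := mem_forests.1 (Finset.mem_coe.1 hG)
      exact Finset.mem_coe.2 (Finset.mem_filter.2 ⟨mem_forests_one.2 ⟨hG.linearTop,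
        linearTop_full hG (by omega)⟩, hG.hasLinearCut_linearTop h2⟩)
    · intro F hF
      obtain ⟨hF, hl⟩ := Finset.mem_filter.1 (Finset.mem_coe.1 hF)
      obtain ⟨hF, h0⟩ := mem_forests_one.1 hF
      exact linearTop_removeLinearTop hF h0
    · intro G hG
      obtain ⟨hG, h2⟩ := mem_forests.1 (Finset.mem_coe.1 hG)
      exact removeLinearTop_linearTop hG h2
  · refine Finset.card_nbij' (removePrimeTop n) (primeTop n) ?_ ?_ ?_ ?_
    · intro F hF
      obtain ⟨hF, hl⟩ := Finset.mem_filter.1 (Finset.mem_coe.1 hF)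
      obtain ⟨hF, h0⟩ := mem_forests_one.1 hF
      exact mem_forests.2 ⟨hF.removePrimeTop hn hl, hF.four_le_numBlocks_removePrimeTop hn h0 hl⟩
    · intro G hG
      obtain ⟨hG, h2⟩ := mem_forests.1 (Finset.mem_coe.1 hG)
      exact Finset.mem_coe.2 (Finset.mem_filter.2 ⟨mem_forests_one.2 ⟨hG.primeTop h2,
        Or.inr ⟨rfl, rfl⟩⟩, hG.not_hasLinearCut_primeTop h2⟩)
    · intro F hF
      obtain ⟨hF, hl⟩ := Finset.mem_filter.1 (Finset.mem_coe.1 hF)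
      obtain ⟨hF, h0⟩ := mem_forests_one.1 hF
      exact primeTop_removePrimeTop h0
    · intro G hG
      obtain ⟨hG, h2⟩ := mem_forests.1 (Finset.mem_coe.1 hG)
      exact removePrimeTop_primeTop (le_trans (by norm_num) h2)

/-! ### The functional equation of the generating function. -/

open PowerSeries

/-- The generating function of the forests whose number of blocks satisfies `Q`. -/
noncomputable def forestSeries (Q : ℕ → Prop) : PowerSeries ℚ :=
  PowerSeries.mk fun n => ((forests n Q).card : ℚ)

theorem forestSeries_succ (m : ℕ) :
    forestSeries (m + 1 ≤ ·) = forestSeries (· = 1) * forestSeries (m ≤ ·) := by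
  ext n
  simp only [forestSeries, coeff_mk, coeff_mul]
  rw [card_forests_congr (Q' := fun k => 1 ≤ k ∧ m ≤ k - 1) (by intros; omega),
    card_forests_succ n (m ≤ ·)]
  push_cast
  rfl

theorem forestSeries_zero : forestSeries (0 ≤ ·) = 1 + forestSeries (1 ≤ ·) := by
  ext n
  simp only [forestSeries, coeff_mk, map_add, coeff_one]
  rcases Nat.eq_zero_or_pos n with rfl | hn
  · rw [card_forests_zero (by simp), forests_zero_eq_empty (by simp)]
    simp
  · rw [card_forests_congr (Q' := (1 ≤ ·)) (by intros; omega), if_neg (by omega), zero_add]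

theorem treeSeries_eq :
    forestSeries (· = 1) = X + forestSeries (2 ≤ ·) + forestSeries (4 ≤ ·) := by
  ext n
  simp only [forestSeries, coeff_mk, map_add, coeff_X]
  rcases n with _ | _ | n
  · simp [forests_zero_eq_empty]
  · have h2 : ∀ m, (forests 1 (m + 2 ≤ ·)).card = 0 := fun m => by
      rw [Finset.card_eq_zero]
      refine Finset.eq_empty_of_forall_notMem fun F hF => ?_
      obtain ⟨c, h1, h2, -⟩ := two_le_numBlocks_iff.1
        (le_trans (by omega : 2 ≤ m + 2) (mem_forests.1 hF).2)
      omega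
    simp [card_forests_one, h2 0, h2 2]
  · rw [if_neg (by omega), zero_add, card_trees (by omega)]
    push_cast
    rfl

/-- The functional equation of the generating function of trees. -/
theorem treeSeries_functional :
    (1 - forestSeries (· = 1)) * (forestSeries (· = 1) - X) =
      forestSeries (· = 1) ^ 2 + forestSeries (· = 1) ^ 4 := by
  have h0 := forestSeries_zero
  have h1 := forestSeries_succ 0
  have h2 := forestSeries_succ 1
  have h3 := forestSeries_succ 2
  have h4 := forestSeries_succ 3
  have ht := treeSeries_eq
  simp only [Nat.reduceAdd] at h1 h2 h3 h4
  rw [h4, h3, h2, h1] at ht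
  rw [h1] at h0
  -- `h0` says that the series of all forests is the inverse of `1 - T`, which removes it from `ht`.
  linear_combination (1 - forestSeries (· = 1)) * ht +
    (forestSeries (· = 1) ^ 2 + forestSeries (· = 1) ^ 4) * h0

theorem constantCoeff_treeSeries : constantCoeff (forestSeries (· = 1)) = 0 := by
  rw [← coeff_zero_eq_constantCoeff_apply, forestSeries, coeff_mk,
    forests_zero_eq_empty (by simp)]
  simp

/-! ### Lagrange inversion. -/

/-- Since `u` is invertible, a multiple of `(X * u) ^ N` cancels the leading term of the remainder,
so `H` expands in powers of `X * u`. -/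
theorem exists_sum_pow_add_X_pow_mul {u : PowerSeries ℚ} (hu : constantCoeff u ≠ 0)
    (H : PowerSeries ℚ) (N : ℕ) : ∃ (q : ℕ → ℚ) (R : PowerSeries ℚ),
      H = ∑ k ∈ Finset.range N, C (q k) * (X * u) ^ k + X ^ N * R := by
  induction N with
  | zero => exact ⟨0, H, by simp⟩
  | succ N ih =>
    obtain ⟨q, R, h⟩ := ih
    set c := constantCoeff R / constantCoeff u ^ N with hc
    have h0 : constantCoeff (R - C c * u ^ N) = 0 := by
      simp only [map_sub, map_mul, constantCoeff_C, map_pow, hc]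
      field_simp
      ring
    obtain ⟨R', hR'⟩ := X_dvd_iff.2 h0
    refine ⟨Function.update q N c, R', ?_⟩
    have hsum : ∑ k ∈ Finset.range N, C (Function.update q N c k) * (X * u) ^ k =
        ∑ k ∈ Finset.range N, C (q k) * (X * u) ^ k :=
      Finset.sum_congr rfl fun k hk => by
        rw [Function.update_of_ne (by simp at hk; omega)]
    rw [Finset.sum_range_succ, hsum, Function.update_self, mul_pow]
    linear_combination h + X ^ N * hR'

/-- With `P = X * u` this is the residue of `k P^(k-n-1) P'`: it vanishes as an exact derivative
unless `k = n`. The factor `v ^ n = X^n P^(-n)` keeps everything in power series. -/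
theorem coeff_derivative_pow_mul {u v : PowerSeries ℚ} (huv : u * v = 1) {n : ℕ} (hn0 : 0 < n)
    (k : ℕ) : (n : ℚ) * coeff n (X ^ k : PowerSeries ℚ) =
      coeff (n - 1) (derivative ℚ ((X * u) ^ k) * v ^ n) := by
  rcases k with _ | k
  · simp [coeff_one, hn0.ne']
  have hd : derivative ℚ ((X * u) ^ (k + 1)) * v ^ n =
      X ^ k * ((k + 1 : PowerSeries ℚ) * (u ^ k * (u + X * derivative ℚ u) * v ^ n)) := by
    rw [Derivation.leibniz_pow]
    simp only [Derivation.leibniz, derivative_X, smul_eq_mul, nsmul_eq_mul]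
    push_cast
    rw [mul_pow]
    ring
  rw [hd]
  -- The exponent is now `k + 1`, so for `n ≤ k` the factor `X ^ k` kills the coefficient at `n -
  -- 1`.
  by_cases hn : n ≤ k
  · rw [coeff_X_pow, if_neg (by omega), mul_zero]
    rw [coeff_X_pow_mul', if_neg (by omega)]
  · obtain ⟨m, rfl⟩ : ∃ m, n = k + 1 + m := ⟨n - (k + 1), by omega⟩
    have hpow : u ^ k * (u + X * derivative ℚ u) * v ^ (k + 1 + m) =
        v ^ m + X * derivative ℚ u * v ^ (m + 1) := by
      have h1 : u ^ k * v ^ k = 1 := by rw [← mul_pow, huv, one_pow]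
      rw [show k + 1 + m = k + (m + 1) by ring, pow_add]
      linear_combination (u + X * derivative ℚ u) * v ^ (m + 1) * h1 + v ^ m * huv
    rw [hpow, show k + 1 + m - 1 = m + k by omega, coeff_X_pow_mul]
    have hv : derivative ℚ v = - (v ^ 2 * derivative ℚ u) := by
      have := congrArg (derivative ℚ) huv
      simp only [Derivation.leibniz, smul_eq_mul, Derivation.map_one_eq_zero] at this
      linear_combination v * this - derivative ℚ v * huv
    rcases m with _ | m
    · have h : (k + 1 : PowerSeries ℚ) = C ((k : ℚ) + 1) := by simp
      rw [h]
      simp [coeff_X_pow]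
    -- The operator `X d/dX` multiplies the coefficient at `m + 1` by `m + 1`, so the right-hand
    -- side has none there.
    · have key : ((m + 1 : ℕ) : PowerSeries ℚ) * (v ^ (m + 1) + X * derivative ℚ u * v ^ (m + 1 + 1))
          = ((m + 1 : ℕ) : PowerSeries ℚ) * v ^ (m + 1) - X * derivative ℚ (v ^ (m + 1)) := by
        rw [Derivation.leibniz_pow, hv]
        simp only [smul_eq_mul, nsmul_eq_mul, Nat.add_sub_cancel]
        ring
      have key' := congrArg (coeff (m + 1)) key
      rw [map_sub, coeff_succ_X_mul, coeff_derivative] at key'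
      have hC : ∀ (j : ℕ), (j : PowerSeries ℚ) = C (j : ℚ) := fun j => by simp
      rw [hC, coeff_C_mul, coeff_C_mul] at key'
      have hz : coeff (m + 1) (v ^ (m + 1) + X * derivative ℚ u * v ^ (m + 1 + 1)) = 0 := by
        have hne : ((m + 1 : ℕ) : ℚ) ≠ 0 := by positivity
        refine (mul_eq_zero.1 (key'.trans ?_)).resolve_left hne
        push_cast
        ring
      have h : (k + 1 : PowerSeries ℚ) = C ((k : ℚ) + 1) := by simp
      rw [h, coeff_C_mul, hz, coeff_X_pow, if_neg (by omega)]
      simp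

/-- **Lagrange inversion**. -/
theorem lagrange_inversion {T u v : PowerSeries ℚ} (hT : constantCoeff T = 0) (huv : u * v = 1)
    (h : T * u.subst T = X) {n : ℕ} (hn : 0 < n) :
    (n : ℚ) * coeff n T = coeff (n - 1) (v ^ n) := by
  have hs : HasSubst T := HasSubst.of_constantCoeff_zero' hT
  have hu : constantCoeff u ≠ 0 := by
    intro h0
    have := congrArg constantCoeff huv
    simp [h0] at this
  -- Expand `X` in powers of `X * u`. Substituting `T` turns `X * u` into `X`, so up to degree `n`
  -- the `q k` are the coefficients of `T`; differentiating instead expresses `1` by the same `q k`.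
  -- The order `n + 1` leaves the coefficient at `n - 1` untouched even after a derivative.
  obtain ⟨q, R, hq⟩ := exists_sum_pow_add_X_pow_mul hu X (n + 1)
  set φ := substAlgHom (R := ℚ) hs with hφ
  have hφX : φ X = T := substAlgHom_X hs
  have hφu : φ u = u.subst T := by rw [hφ, coe_substAlgHom]
  have hφC : ∀ r : ℚ, φ (C r) = C r := fun r => φ.commutes r
  have hXT : X ∣ T := X_dvd_iff.2 hT
  have e1 : T = ∑ k ∈ Finset.range (n + 1), C (q k) * X ^ k + T ^ (n + 1) * φ R := by
    have := congrArg φ hq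
    simp only [map_add, map_sum, map_mul, map_pow, hφX, hφC, hφu, h] at this
    exact this
  have e2 : (1 : PowerSeries ℚ) = ∑ k ∈ Finset.range (n + 1),
      C (q k) * derivative ℚ ((X * u) ^ k) + derivative ℚ (X ^ (n + 1) * R) := by
    have := congrArg (derivative ℚ) hq
    simpa only [map_add, map_sum, Derivation.leibniz, derivative_C, smul_eq_mul, mul_zero,
      add_zero, derivative_X] using this
  have e3 : coeff n (T ^ (n + 1) * φ R) = 0 :=
    X_pow_dvd_iff.1 ((pow_dvd_pow_of_dvd hXT (n + 1)).trans (Dvd.intro _ rfl)) n (by omega)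
  have e4 : coeff (n - 1) (derivative ℚ (X ^ (n + 1) * R) * v ^ n) = 0 := by
    refine X_pow_dvd_iff.1 (?_ : X ^ n ∣ _) (n - 1) (by omega)
    refine Dvd.dvd.mul_right ?_ _
    rw [Derivation.leibniz, Derivation.leibniz_pow, derivative_X]
    simp only [smul_eq_mul, nsmul_eq_mul, Nat.add_sub_cancel, mul_one]
    exact ⟨X * derivative ℚ R + R * ((n + 1 : ℕ) : PowerSeries ℚ), by ring⟩
  calc (n : ℚ) * coeff n T
      = ∑ k ∈ Finset.range (n + 1), q k * (n * coeff n (X ^ k : PowerSeries ℚ)) := by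
        conv_lhs => rw [e1]
        rw [map_add, e3, add_zero, map_sum, Finset.mul_sum]
        exact Finset.sum_congr rfl fun k _ => by rw [coeff_C_mul]; ring
    _ = ∑ k ∈ Finset.range (n + 1),
          q k * coeff (n - 1) (derivative ℚ ((X * u) ^ k) * v ^ n) :=
        Finset.sum_congr rfl fun k _ => by rw [coeff_derivative_pow_mul huv hn]
    _ = coeff (n - 1) (v ^ n) := by
        conv_rhs => rw [← one_mul (v ^ n), e2]
        rw [add_mul, map_add, e4, add_zero, Finset.sum_mul, map_sum]
        exact Finset.sum_congr rfl fun k _ => by rw [mul_assoc, coeff_C_mul]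

/-! ### Extracting the closed formula. -/

theorem coeff_geometric_pow {i : ℕ} (hi : 0 < i) (j : ℕ) :
    coeff j ((mk 1 : PowerSeries ℚ) ^ i) = ((i - 1 + j).choose (i - 1) : ℚ) := by
  obtain ⟨d, rfl⟩ : ∃ d, i = d + 1 := ⟨i - 1, by omega⟩
  rw [mk_one_pow_eq_mk_choose_add, coeff_mk]
  simp

/-- The index `k` counts the factors `1 + X^2` that contribute `X^2`; the remaining degree `N - i -
2k` comes from the geometric series. -/
theorem coeff_branching_pow {i N : ℕ} (hi : 0 < i) :
    coeff N ((X * (1 + X ^ 2) * mk 1 : PowerSeries ℚ) ^ i) =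
      if i ≤ N then ∑ k ∈ Finset.Icc 0 (min i ((N - i) / 2)),
        ((i.choose k : ℚ) * ((N - 2 * k - 1).choose (i - 1) : ℚ)) else 0 := by
  rw [mul_pow, mul_pow, mul_assoc, coeff_X_pow_mul']
  refine ite_congr rfl (fun hiN => ?_) fun _ => rfl
  have hexp : (1 + X ^ 2 : PowerSeries ℚ) ^ i * (mk 1) ^ i =
      ∑ k ∈ Finset.range (i + 1), X ^ (2 * k) * (C (i.choose k : ℚ) * (mk 1) ^ i) := by
    rw [add_comm, add_pow, Finset.sum_mul]
    refine Finset.sum_congr rfl fun k _ => ?_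
    have : (C (i.choose k : ℚ) : PowerSeries ℚ) = (i.choose k : PowerSeries ℚ) := by simp
    rw [this, one_pow, pow_mul]
    ring
  rw [hexp, map_sum]
  symm
  refine Finset.sum_subset_zero_on_sdiff (fun k hk => ?_) (fun k hk => ?_) fun k hk => ?_
  · simp only [Finset.mem_Icc, Finset.mem_range, le_min_iff] at hk ⊢
    omega
  · simp only [Finset.mem_sdiff, Finset.mem_Icc, Finset.mem_range, le_min_iff] at hk
    rw [coeff_X_pow_mul', if_neg (by omega)]
  · simp only [Finset.mem_Icc, le_min_iff] at hk
    rw [coeff_X_pow_mul', if_pos (by omega), coeff_C_mul, coeff_geometric_pow hi]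
    congr 3
    omega

/-- The number of trees with `n` leaves is given by the closed formula. -/
theorem card_trees_eq_formula {n : ℕ} (hn : 1 ≤ n) :
    ((forests n (· = 1)).card : ℚ) = intervalPosetFormula n := by
  rw [intervalPosetFormula]
  split_ifs with h1
  · subst h1
    rw [card_forests_one, Nat.cast_one]
  set T := forestSeries (· = 1) with hTdef
  have hT : constantCoeff T = 0 := constantCoeff_treeSeries
  have hsT : HasSubst T := HasSubst.of_constantCoeff_zero' hT
  set E : PowerSeries ℚ := mk 1 with hE
  have hE1 : E * (1 - X) = 1 := mk_one_mul_one_sub_eq_one ℚ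
  set w : PowerSeries ℚ := X * (1 + X ^ 2) * E with hw
  have hw0 : constantCoeff w = 0 := by simp [hw]
  have hsw : HasSubst w := HasSubst.of_constantCoeff_zero' hw0
  have huv : (1 - w) * E.subst w = 1 := by
    have := congrArg (substAlgHom (R := ℚ) hsw) hE1
    rw [map_mul, map_sub, map_one, substAlgHom_X, coe_substAlgHom] at this
    rw [mul_comm]
    exact this
  -- This is the functional equation divided by `1 - T`, whose inverse is `E` evaluated at `T`.
  have hX : T * (1 - w).subst T = X := by
    have hET := congrArg (substAlgHom (R := ℚ) hsT) hE1
    rw [map_mul, map_sub, map_one, substAlgHom_X] at hET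
    rw [← coe_substAlgHom hsT, map_sub, map_one, hw, map_mul, map_mul, map_add, map_one, map_pow,
      substAlgHom_X]
    have hf := treeSeries_functional
    rw [← hTdef] at hf
    linear_combination (substAlgHom (R := ℚ) hsT E) * hf + (X - T) * hET
  have hlag := lagrange_inversion hT huv hX (n := n) (by omega)
  have hcoeff : coeff n T = ((forests n (· = 1)).card : ℚ) := coeff_mk _ _
  rw [hcoeff, ← subst_pow hsw, coeff_subst' hsw] at hlag
  have hvanish : ∀ d, n ≤ d → coeff (n - 1) (w ^ d) = 0 := fun d hd =>
    X_pow_dvd_iff.1 (pow_dvd_pow_of_dvd (X_dvd_iff.2 hw0) d) _ (by omega)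
  rw [finsum_eq_sum_of_support_subset (s := Finset.Icc 0 (n - 1))] at hlag
  · have hn0 : (n : ℚ) ≠ 0 := by positivity
    rw [one_div, eq_inv_mul_iff_mul_eq₀ hn0, hlag]
    symm
    refine Finset.sum_subset_zero_on_sdiff (fun k hk => ?_) (fun k hk => ?_) fun i hi => ?_
    · simp only [Finset.mem_Icc] at hk ⊢
      omega
    -- The extra term `i = 0` is the constant `1`, which has no coefficient at `n - 1 > 0`.
    · simp only [Finset.mem_sdiff, Finset.mem_Icc] at hk
      obtain rfl : k = 0 := by omega
      rw [pow_zero, coeff_one, if_neg (by omega), smul_zero]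
    · simp only [Finset.mem_Icc] at hi
      rw [hw, coeff_branching_pow (by omega), if_pos (by omega), coeff_geometric_pow (by omega),
        smul_eq_mul, Finset.mul_sum]
      refine Finset.sum_congr (by rw [Nat.sub_right_comm]) fun k _ => ?_
      rw [mul_assoc, show n - 1 + i = n + i - 1 by omega, show n - 1 - 2 * k - 1 = n - 2 * k - 2 by
        omega, Nat.choose_symm_of_eq_add (show n + i - 1 = (n - 1) + i by omega)]
  · intro d hd
    simp only [Finset.coe_Icc, Set.mem_Icc, zero_le, true_and]
    by_contra! hlt
    exact hd (by dsimp only; rw [hvanish d (by omega), smul_zero])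

/-! ### Contiguous sets of an arrangement form a forest. -/

/-- The values `[x, y) ⊆ [0, n)` are contiguous if the values are arranged by increasing `f`. -/
def Contiguous (n : ℕ) (f : ℕ → ℕ) (x y : ℕ) : Prop :=
  x < y ∧ y ≤ n ∧ ∀ u v w, x ≤ u → u < y → x ≤ w → w < y → v < n → f u < f v → f v < f w →
    x ≤ v ∧ v < y

theorem isForest_contiguous {n : ℕ} {f : ℕ → ℕ} (hf : Set.InjOn f (Set.Iio n)) :
    IsForest n (Contiguous n f) where
  lt h := h.1
  le h := h.2.1
  unit {x} hx := ⟨by omega, by omega, fun u v w h1 h2 h3 h4 h5 h6 h7 => by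
    obtain rfl : u = w := by omega
    omega⟩
  overlap {x y z w} h1 h2 h3 h4 h5 := by
    obtain ⟨-, b1, c1⟩ := h4
    obtain ⟨-, b2, c2⟩ := h5
    have hne : ∀ p q, p < n → q < n → p < q → f p ≠ f q := fun p q hp hq hpq he =>
      hpq.ne (hf hp hq he)
    refine ⟨⟨h1, by omega, ?_⟩, ⟨h2, b1, ?_⟩, ⟨h3, b2, ?_⟩, ⟨by omega, b2, ?_⟩⟩
    · intro u v t u1 u2 t1 t2 hv e1 e2
      obtain ⟨v1, v2⟩ := c1 u v t u1 (by omega) t1 (by omega) hv e1 e2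
      refine ⟨v1, ?_⟩
      -- The value `z` belongs to `[y, w)` but not to `[x, z)`. Whether it is placed before `u`,
      -- after `t` or between them, convexity of one of the two sets fails. The other difference
      -- uses `x` symmetrically.
      by_contra! hyv
      have n1 := hne u z (by omega) (by omega) (by omega)
      have n2 := hne t z (by omega) (by omega) (by omega)
      rcases lt_or_gt_of_ne n1 with e | e
      · rcases lt_or_gt_of_ne n2 with e' | e'
        · have := c2 v t z hyv (by omega) h2.le h3 (by omega) e2 e'
          omega
        · have := c1 u z t u1 (by omega) t1 (by omega) (by omega) e e'
          omega
      · have := c2 z u v h2.le h3 hyv (by omega) (by omega) e e1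
        omega
    · intro u v t u1 u2 t1 t2 hv e1 e2
      have := c1 u v t (by omega) (by omega) (by omega) (by omega) hv e1 e2
      have := c2 u v t (by omega) (by omega) (by omega) (by omega) hv e1 e2
      omega
    · intro u v t u1 u2 t1 t2 hv e1 e2
      obtain ⟨v1, v2⟩ := c2 u v t (by omega) (by omega) (by omega) (by omega) hv e1 e2
      refine ⟨?_, v2⟩
      by_contra! hyv
      have n1 := hne x u (by omega) (by omega) (by omega)
      have n2 := hne x t (by omega) (by omega) (by omega)
      rcases lt_or_gt_of_ne n1 with e | e
      · have := c1 x u v (by omega) (by omega) (by omega) (by omega) (by omega) e e1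
        omega
      · rcases lt_or_gt_of_ne n2 with e' | e'
        · have := c2 u x t (by omega) (by omega) (by omega) (by omega) (by omega) e e'
          omega
        · have := c1 v t x (by omega) (by omega) (by omega) (by omega) (by omega) e2 e'
          omega
    · intro u v t u1 u2 t1 t2 hv e1 e2
      rcases lt_trichotomy (f v) (f y) with e | e | e
      · by_cases hu : u < z
        · have := c1 u v y (by omega) (by omega) (by omega) (by omega) (by omega) e1 e
          omega
        · have := c2 u v y (by omega) (by omega) (by omega) (by omega) (by omega) e1 e
          omega
      · have := hf (show v ∈ Set.Iio n from hv) (show y ∈ Set.Iio n by simp; omega) e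
        omega
      · by_cases hu : t < z
        · have := c1 y v t (by omega) (by omega) (by omega) (by omega) (by omega) e e2
          omega
        · have := c2 y v t (by omega) (by omega) (by omega) (by omega) (by omega) e e2
          omega
  three {x a b y} h1 h2 h3 h4 := by
    by_contra! hcon
    obtain ⟨l1, m1, c1⟩ := h1
    obtain ⟨l2, m2, c2⟩ := h2
    obtain ⟨l3, m3, c3⟩ := h3
    obtain ⟨l4, m4, c4⟩ := h4
    obtain ⟨d1, d2⟩ := hcon
    simp only [Contiguous, not_and, not_forall] at d1 d2
    obtain ⟨p, r, q, p1, p2, q1, q2, r0, e1, e2, r1⟩ := d1 (by omega) (by omega)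
    obtain ⟨p', r', q', p1', p2', q1', q2', r0', e1', e2', r1'⟩ := d2 (by omega) (by omega)
    -- The three pieces occupy disjoint stretches of the arrangement. Here `r` puts the third piece
    -- between the first two, and `r'` puts the first between the last two, which is impossible
    -- together.
    have R := c4 p r q p1 (by omega) q1 (by omega) r0 e1 e2
    have R' := c4 p' r' q' (by omega) (by omega) (by omega) (by omega) r0' e1' e2'
    have rb : b ≤ r := by omega
    have ra : r' < a := by omega
    have P : ∀ u v w, x ≤ u → u < a → x ≤ w → w < a → v < n → f u < f v → f v < f w → v < a :=
      fun u v w i1 i2 i3 i4 i5 i6 i7 => (c1 u v w i1 i2 i3 i4 i5 i6 i7).2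
    have S : ∀ u v w, b ≤ u → u < y → b ≤ w → w < y → v < n → f u < f v → f v < f w → b ≤ v :=
      fun u v w i1 i2 i3 i4 i5 i6 i7 => (c3 u v w i1 i2 i3 i4 i5 i6 i7).1
    have M : ∀ u v w, a ≤ u → u < b → a ≤ w → w < b → v < n → f u < f v → f v < f w →
      a ≤ v ∧ v < b := c2
    have hne : f r ≠ f r' := fun he => by
      have := hf (show r ∈ Set.Iio n from r0) (show r' ∈ Set.Iio n from r0') he
      omega
    by_cases hp : p < a
    · have hq : a ≤ q := by
        by_contra! hq
        have := P p r q p1 hp q1 hq r0 e1 e2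
        omega
      by_cases hp' : p' < b
      · have hq' : b ≤ q' := by
          by_contra! hq'
          have := M p' r' q' p1' hp' q1' hq' r0' e1' e2'
          omega
        rcases lt_or_gt_of_ne hne with e | e
        · have := S r r' q' rb R.2 hq' q2' r0' e e2'
          omega
        · have := M p' r' q p1' hp' hq q2 r0' e1' (e.trans e2)
          omega
      · push Not at hp'
        rcases lt_or_gt_of_ne hne with e | e
        · have := P p r r' p1 hp R'.1 ra r0 e1 e
          omega
        · have := S p' r' r hp' p2' rb R.2 r0' e1' e
          omega
    · push Not at hp
      have hq : q < a := by
        by_contra! hq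
        have := M p r q hp p2 hq q2 r0 e1 e2
        omega
      by_cases hp' : p' < b
      · have hq' : b ≤ q' := by
          by_contra! hq'
          have := M p' r' q' p1' hp' q1' hq' r0' e1' e2'
          omega
        rcases lt_or_gt_of_ne hne with e | e
        · have := S r r' q' rb R.2 hq' q2' r0' e e2'
          omega
        · have := P r' r q R'.1 ra q1 hq r0 e e2
          omega
      · push Not at hp'
        have hq' : q' < b := by
          by_contra! hq'
          have := S p' r' q' hp' p2' hq' q2' r0' e1' e2'
          omega
        rcases lt_or_gt_of_ne hne with e | e
        · have := M p r' q' hp p2 q1' hq' r0' (e1.trans e) e2'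
          omega
        · have := S p' r' r hp' p2' rb R.2 r0' e1' e
          omega

theorem contiguous_full {n : ℕ} (f : ℕ → ℕ) (hn : 0 < n) : Contiguous n f 0 n :=
  ⟨hn, le_rfl, fun _ _ _ _ _ _ _ hv _ _ => ⟨Nat.zero_le _, hv⟩⟩

theorem exists_bound (f : ℕ → ℕ) (n : ℕ) : ∃ N, ∀ v < n, f v < N :=
  ⟨(Finset.range n).sup f + 1, fun _ hv =>
    Nat.lt_succ_of_le (Finset.le_sup (f := f) (Finset.mem_range.2 hv))⟩

/-- Reversing the arrangement changes no contiguous set, so that the first value may be assumed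
not to come before the last one. -/
theorem exists_contiguous_reverse {n : ℕ} {F : ℕ → ℕ → Prop}
    (h : ∃ f, Set.InjOn f (Set.Iio n) ∧ F = Contiguous n f) :
    ∃ f, Set.InjOn f (Set.Iio n) ∧ F = Contiguous n f ∧ f (n - 1) ≤ f 0 := by
  obtain ⟨f, hf, rfl⟩ := h
  by_cases hle : f (n - 1) ≤ f 0
  · exact ⟨f, hf, rfl, hle⟩
  obtain ⟨N, hN⟩ := exists_bound f n
  -- As `N` exceeds all `f v`, the truncated subtraction reverses the order strictly.
  refine ⟨fun v => N - f v, ?_, ?_, by dsimp only; omega⟩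
  · intro u hu v hv he
    have h1 := hN u hu
    have h2 := hN v hv
    dsimp only at he
    exact hf hu hv (by omega)
  · funext x y
    refine propext (and_congr_right fun hxy => and_congr_right fun hy => ?_)
    constructor
    · intro h u v w u1 u2 w1 w2 hv e1 e2
      dsimp only at e1 e2 h
      have := hN u (by omega)
      have := hN v hv
      have := hN w (by omega)
      exact h w v u w1 w2 u1 u2 hv (by omega) (by omega)
    · intro h u v w u1 u2 w1 w2 hv e1 e2
      dsimp only at e1 e2 h
      have := hN u (by omega)
      have := hN v hv
      have := hN w (by omega)
      exact h w v u w1 w2 u1 u2 hv (by omega) (by omega)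

/-! ### Inflating an arrangement of the blocks. -/

/-- `[a, b)` is a block: `a` and `b` are consecutive cuts. -/
def IsBlock (n : ℕ) (G : ℕ → ℕ → Prop) (a b : ℕ) : Prop :=
  a < b ∧ b ≤ n ∧ IsCut G a ∧ IsCut G b ∧ ∀ e, a < e → e < b → ¬ IsCut G e

open Classical in
/-- The index of the block that contains `v`, starting from `0`. -/
noncomputable def blockIndex (G : ℕ → ℕ → Prop) (v : ℕ) : ℕ :=
  Nat.count (fun c => IsCut G (c + 1)) v

theorem blockIndex_mono (G : ℕ → ℕ → Prop) : Monotone (blockIndex G) := fun _ _ h => by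
  classical
  exact Nat.count_monotone _ h

theorem blockIndex_eq_iff {G : ℕ → ℕ → Prop} {u v : ℕ} (h : u ≤ v) :
    blockIndex G u = blockIndex G v ↔ ∀ e, u < e → e ≤ v → ¬ IsCut G e := by
  classical
  obtain ⟨d, rfl⟩ := Nat.exists_eq_add_of_le h
  rw [blockIndex, blockIndex, Nat.count_add, left_eq_add, Nat.count_iff_forall_not]
  constructor
  · intro h e h1 h2 h3
    exact h (e - u - 1) (by omega) (by rwa [show u + (e - u - 1) + 1 = e by omega])
  · intro h k hk
    exact h _ (by omega) (by omega)

theorem exists_block {n : ℕ} {G : ℕ → ℕ → Prop} (h : IsForest n G) {v : ℕ} (hv : v < n) :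
    ∃ a b, IsBlock n G a b ∧ a ≤ v ∧ v < b := by
  classical
  have hex : ∃ e, v < e ∧ IsCut G e := ⟨n, hv, h.isCut_of_le le_rfl⟩
  obtain ⟨b1, b2⟩ := Nat.find_spec hex
  have a1 : IsCut G (Nat.findGreatest (IsCut G) v) :=
    Nat.findGreatest_spec (Nat.zero_le v) (isCut_zero G)
  have a2 := Nat.findGreatest_le (P := IsCut G) v
  refine ⟨_, _, ⟨by omega, Nat.find_min' hex ⟨hv, h.isCut_of_le le_rfl⟩, a1, b2,
    fun e e1 e2 e3 => ?_⟩, a2, b1⟩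
  by_cases hev : e ≤ v
  · exact Nat.findGreatest_is_greatest e1 hev e3
  · exact Nat.find_min hex e2 ⟨by omega, e3⟩

theorem IsBlock.blockIndex_eq {n a b u v : ℕ} {G : ℕ → ℕ → Prop} (h : IsBlock n G a b)
    (hu : a ≤ u) (hub : u < b) : blockIndex G v = blockIndex G u ↔ a ≤ v ∧ v < b := by
  obtain ⟨h1, h2, h3, h4, h5⟩ := h
  rcases le_total u v with huv | hvu
  · rw [eq_comm, blockIndex_eq_iff huv]
    constructor
    · intro h
      refine ⟨by omega, ?_⟩
      by_contra! hbv
      exact h b hub hbv h4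
    · intro h e e1 e2
      exact h5 e (by omega) (by omega)
  · rw [blockIndex_eq_iff hvu]
    constructor
    · intro h
      refine ⟨?_, by omega⟩
      by_contra! hbv
      exact h a hbv hu h3
    · intro h e e1 e2
      exact h5 e (by omega) (by omega)

/-- A discrete intermediate value property: the index grows by at most one per step. -/
theorem exists_blockIndex_eq {G : ℕ → ℕ → Prop} {x l : ℕ} (hx : blockIndex G x ≤ l) (d : ℕ)
    (hl : l ≤ blockIndex G (x + d)) : ∃ u, x ≤ u ∧ u ≤ x + d ∧ blockIndex G u = l := by
  classical
  induction d with
  | zero => exact ⟨x, le_rfl, le_rfl, le_antisymm hx hl⟩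
  | succ d ih =>
    by_cases h : l ≤ blockIndex G (x + d)
    · obtain ⟨u, h1, h2, h3⟩ := ih h
      exact ⟨u, h1, by omega, h3⟩
    · refine ⟨x + (d + 1), by omega, le_rfl, ?_⟩
      have : blockIndex G (x + (d + 1)) ≤ blockIndex G (x + d) + 1 := by
        rw [blockIndex, blockIndex, ← add_assoc, Nat.count_succ]
        split_ifs <;> omega
      omega

theorem numBlocks_eq_blockIndex {n : ℕ} (G : ℕ → ℕ → Prop) (hn : 0 < n) :
    numBlocks n G = blockIndex G (n - 1) + 1 := by
  classical
  obtain ⟨m, rfl⟩ : ∃ m, n = 1 + m := ⟨n - 1, by omega⟩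
  rw [numBlocks, Nat.count_add, blockIndex, Nat.count_succ, Nat.count_zero, if_pos (isCut_zero G),
    zero_add, add_comm, Nat.add_sub_cancel_left]
  congr 2
  funext k
  rw [add_comm]

/-- The arrangement `f` of `[0, n)` arises by arranging the blocks of the forest `G` among each
other by `π`, and each block internally such that its contiguous sets are the members of `G`. -/
structure IsInflation (n : ℕ) (G : ℕ → ℕ → Prop) (π f : ℕ → ℕ) : Prop where
  forest : IsForest n G
  inj : Set.InjOn f (Set.Iio n)
  across : ∀ u v, u < n → v < n → blockIndex G u ≠ blockIndex G v →
    (f u < f v ↔ π (blockIndex G u) < π (blockIndex G v))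
  within : ∀ x y, x < y → y ≤ n → (∀ c, x < c → c < y → ¬ IsCut G c) →
    (G x y ↔ ∀ u v w, x ≤ u → u < y → x ≤ w → w < y → v < n → blockIndex G v = blockIndex G x →
      f u < f v → f v < f w → x ≤ v ∧ v < y)
  ends : ∀ a b, IsBlock n G a b → f (b - 1) ≤ f a

theorem exists_isInflation {n : ℕ} {G : ℕ → ℕ → Prop} (h : IsForest n G)
    (hb : ∀ a b, IsBlock n G a b →
      ∃ f, Set.InjOn f (Set.Iio (b - a)) ∧ restr a b G = Contiguous (b - a) f)
    {π : ℕ → ℕ} (hπ : Set.InjOn π (Set.Iio (numBlocks n G))) : ∃ f, IsInflation n G π f := by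
  classical
  have hb' : ∀ a, ∃ f, ∀ b, IsBlock n G a b → Set.InjOn f (Set.Iio (b - a)) ∧
      restr a b G = Contiguous (b - a) f ∧ f (b - a - 1) ≤ f 0 := by
    intro a
    by_cases hex : ∃ b, IsBlock n G a b
    · obtain ⟨b, hab⟩ := hex
      obtain ⟨f, hf⟩ := exists_contiguous_reverse (hb a b hab)
      refine ⟨f, fun b' hab' => ?_⟩
      obtain rfl : b = b' := by
        obtain ⟨h1, h2, h3, h4, h5⟩ := hab
        obtain ⟨h1', h2', h3', h4', h5'⟩ := hab'
        rcases lt_trichotomy b b' with e | e | e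
        · exact absurd h4 (h5' b h1 e)
        · exact e
        · exact absurd h4' (h5 b' h1' e)
      exact hf
    · exact ⟨id, fun b hab => absurd ⟨b, hab⟩ hex⟩
  choose g hg using hb'
  set st : ℕ → ℕ := Nat.findGreatest (IsCut G) with hst
  have hst_eq : ∀ a b v, IsBlock n G a b → a ≤ v → v < b → st v = a := by
    intro a b v hab hav hvb
    have h1 : a ≤ st v := Nat.le_findGreatest hav hab.2.2.1
    have h2 : IsCut G (st v) := Nat.findGreatest_spec hav hab.2.2.1
    have h3 : st v ≤ v := Nat.findGreatest_le v
    by_contra hne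
    exact hab.2.2.2.2 _ (by omega) (by omega) h2
  obtain ⟨N, hN⟩ := exists_bound (fun v => g (st v) (v - st v)) n
  -- A lexicographic order: `N` bounds the inner positions, so `π` decides between blocks and `g`
  -- inside a block.
  set f : ℕ → ℕ := fun v => N * π (blockIndex G v) + g (st v) (v - st v) with hf
  have hidx : ∀ v, v < n → blockIndex G v < numBlocks n G := fun v hv => by
    rw [numBlocks_eq_blockIndex G (by omega)]
    exact Nat.lt_succ_of_le (blockIndex_mono G (by omega))
  have across : ∀ u v, u < n → v < n → blockIndex G u ≠ blockIndex G v →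
      (f u < f v ↔ π (blockIndex G u) < π (blockIndex G v)) := by
    have key : ∀ u v, u < n → v < n → π (blockIndex G u) < π (blockIndex G v) → f u < f v := by
      intro u v hu hv hlt
      have := hN u hu
      have h2 : N * π (blockIndex G u) + N ≤ N * π (blockIndex G v) := by
        rw [← Nat.mul_succ]
        exact Nat.mul_le_mul_left N hlt
      simp only [hf]
      omega
    intro u v hu hv hne
    refine ⟨fun hlt => ?_, key u v hu hv⟩
    by_contra! hle
    rcases hle.lt_or_eq with e | e
    · exact absurd (key v u hv hu e) (by omega)
    · exact hne (hπ (hidx u hu) (hidx v hv) e.symm)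
  have hin : ∀ a b, IsBlock n G a b → ∀ u v, a ≤ u → u < b → a ≤ v → v < b →
      (f u < f v ↔ g a (u - a) < g a (v - a)) := by
    intro a b hab u v u1 u2 v1 v2
    have := (hab.blockIndex_eq (v := v) u1 u2).2 ⟨v1, v2⟩
    simp only [hf, this, hst_eq a b u hab u1 u2, hst_eq a b v hab v1 v2]
    omega
  refine ⟨f, h, ?_, across, ?_, ?_⟩
  · intro u hu v hv he
    by_cases hi : blockIndex G u = blockIndex G v
    · obtain ⟨a, b, hab, u1, u2⟩ := exists_block h hu
      obtain ⟨v1, v2⟩ := (hab.blockIndex_eq (v := v) u1 u2).1 hi.symm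
      have e1 := hin a b hab u v u1 u2 v1 v2
      have e2 := hin a b hab v u v1 v2 u1 u2
      have := (hg a b hab).1 (show u - a ∈ Set.Iio (b - a) by simp; omega)
        (show v - a ∈ Set.Iio (b - a) by simp; omega) (by omega)
      omega
    · exfalso
      have e1 := across u v hu hv hi
      have e2 := across v u hv hu (Ne.symm hi)
      have : π (blockIndex G u) = π (blockIndex G v) := by omega
      exact hi (hπ (hidx u hu) (hidx v hv) this)
  · intro x y hxy hy hno
    obtain ⟨a, b, hab, x1, x2⟩ := exists_block h (show x < n by omega)
    have hyb : y ≤ b := by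
      by_contra! hby
      exact hno b x2 hby hab.2.2.2.1
    have hr := congrFun (congrFun (hg a b hab).2.1 (x - a)) (y - a)
    have hG : G x y ↔ restr a b G (x - a) (y - a) := by
      simp only [restr, show x - a + a = x by omega, show y - a + a = y by omega, hyb, true_and]
    rw [hG, hr]
    constructor
    · rintro ⟨-, -, hc⟩ u v w u1 u2 w1 w2 hv hiv e1 e2
      obtain ⟨v1, v2⟩ := (hab.blockIndex_eq (v := v) x1 x2).1 hiv
      have := hc (u - a) (v - a) (w - a) (by omega) (by omega) (by omega) (by omega) (by omega)
        ((hin a b hab u v (by omega) (by omega) v1 v2).1 e1)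
        ((hin a b hab v w v1 v2 (by omega) (by omega)).1 e2)
      omega
    · intro hc
      refine ⟨by omega, by omega, fun u v w u1 u2 w1 w2 hv e1 e2 => ?_⟩
      have hbn := hab.2.1
      have := hc (u + a) (v + a) (w + a) (by omega) (by omega) (by omega) (by omega) (by omega)
        ((hab.blockIndex_eq x1 x2).2 (by omega))
        ((hin a b hab _ _ (by omega) (by omega) (by omega) (by omega)).2
          (by simpa using e1))
        ((hin a b hab _ _ (by omega) (by omega) (by omega) (by omega)).2
          (by simpa using e2))
      omega
  · intro a b hab
    have h1 := hab.1
    have h2 := hin a b hab a (b - 1) le_rfl h1 (by omega) (by omega)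
    have h3 := (hg a b hab).2.2
    rw [Nat.sub_self, show b - 1 - a = b - a - 1 by omega] at h2
    omega

namespace IsInflation

variable {n : ℕ} {G : ℕ → ℕ → Prop} {π f : ℕ → ℕ}

/-- A value of another block compares alike with all values of this block, so it never lies between
two of them. -/
theorem contiguous_iff_of_no_cut (h : IsInflation n G π f) {x y : ℕ} (hxy : x < y) (hy : y ≤ n)
    (hno : ∀ c, x < c → c < y → ¬ IsCut G c) : Contiguous n f x y ↔ G x y := by
  rw [h.within x y hxy hy hno]
  constructor
  · rintro ⟨-, -, hc⟩ u v w u1 u2 w1 w2 hv - e1 e2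
    exact hc u v w u1 u2 w1 w2 hv e1 e2
  · refine fun hc => ⟨hxy, hy, fun u v w u1 u2 w1 w2 hv e1 e2 => ?_⟩
    have hu : blockIndex G x = blockIndex G u :=
      (blockIndex_eq_iff u1).2 fun e e1 e2 => hno e e1 (by omega)
    have hw : blockIndex G x = blockIndex G w :=
      (blockIndex_eq_iff w1).2 fun e e1 e2 => hno e e1 (by omega)
    by_cases hi : blockIndex G v = blockIndex G x
    · exact hc u v w u1 u2 w1 w2 hv hi e1 e2
    · have h1 := (h.across u v (by omega) hv (by rw [← hu]; exact Ne.symm hi)).1 e1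
      have h2 := (h.across v w hv (by omega) (by rw [← hw]; exact hi)).1 e2
      rw [← hu] at h1
      rw [← hw] at h2
      omega

theorem blockIndex_lt {u v c : ℕ} (hc : IsCut G c) (hu : u < c) (hv : c ≤ v) :
    blockIndex G u < blockIndex G v := by
  refine lt_of_le_of_ne (blockIndex_mono G (by omega)) fun he => ?_
  exact (blockIndex_eq_iff (by omega)).1 he c hu hv hc

/-- This is where `ends` is needed. If `x` is interior to a block `[a, b)`, then `a` comes after `b
- 1` and before `c`, so contiguity would force `a` into `[x, y)`; the argument for `y` is symmetric.
Thus no part of a block joins its neighbours. -/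
theorem contiguous_iff_of_cut_linear (h : IsInflation n G id f) {x y c : ℕ} (hy : y ≤ n)
    (hxc : x < c) (hcy : c < y) (hc : IsCut G c) :
    Contiguous n f x y ↔ IsCut G x ∧ IsCut G y := by
  have key : ∀ u v d, IsCut G d → u < d → d ≤ v → v < n → f u < f v := fun u v d hd hu hv hn => by
    have := blockIndex_lt hd hu hv
    exact (h.across u v (by omega) hn this.ne).2 this
  constructor
  · rintro ⟨-, -, hcon⟩
    constructor
    · obtain ⟨a, b, hab, x1, x2⟩ := exists_block h.forest (show x < n by omega)
      have hbc : b ≤ c := by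
        by_contra! hlt
        exact hab.2.2.2.2 c (by omega) hlt hc
      rcases x1.eq_or_lt with rfl | x1
      · exact hab.2.2.1
      · exfalso
        have e1 := h.ends a b hab
        have hne : f (b - 1) ≠ f a := fun he => by
          have := h.inj (show b - 1 ∈ Set.Iio n by simp; omega) (show a ∈ Set.Iio n by simp; omega)
            he
          omega
        have := hcon (b - 1) a c (by omega) (by omega) (by omega) (by omega) (by omega)
          (by omega) (key a c c hc (by omega) le_rfl (by omega))
        omega
    · rcases hy.eq_or_lt with rfl | hyn
      · exact h.forest.isCut_of_le le_rfl
      obtain ⟨a, b, hab, x1, x2⟩ := exists_block h.forest hyn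
      have hbc : c ≤ a := by
        by_contra! hlt
        exact hab.2.2.2.2 c (by omega) (by omega) hc
      have hbn := hab.2.1
      rcases x1.eq_or_lt with rfl | x1
      · exact hab.2.2.1
      · exfalso
        have e1 := h.ends a b hab
        have hne : f (b - 1) ≠ f a := fun he => by
          have := h.inj (show b - 1 ∈ Set.Iio n by simp; omega) (show a ∈ Set.Iio n by simp; omega)
            he
          omega
        have := hcon x (b - 1) a (by omega) (by omega) (by omega) (by omega) (by omega)
          (key x (b - 1) c hc (by omega) (by omega) (by omega)) (by omega)
        omega
  · rintro ⟨hx, hyc⟩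
    refine ⟨by omega, hy, fun u v w u1 u2 w1 w2 hv e1 e2 => ⟨?_, ?_⟩⟩
    · by_contra! hlt
      have := key v u x hx hlt u1 (by omega)
      omega
    · by_contra! hlt
      have := key w v y hyc w2 hlt hv
      omega

/-- If `π` is a simple arrangement of the blocks, a contiguous set that meets two blocks is
everything. -/
theorem contiguous_iff_of_cut_simple (h : IsInflation n G π f)
    (hπ : ∀ i j, i < j → j < numBlocks n G → (0 < i ∨ j + 1 < numBlocks n G) →
      ∃ l < numBlocks n G, (l < i ∨ j < l) ∧
        ∃ p q, i ≤ p ∧ p ≤ j ∧ i ≤ q ∧ q ≤ j ∧ π p < π l ∧ π l < π q)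
    (h3 : 3 ≤ numBlocks n G)
    {x y c : ℕ} (hy : y ≤ n) (hxc : x < c) (hcy : c < y) (hc : IsCut G c) :
    Contiguous n f x y ↔ x = 0 ∧ y = n := by
  constructor
  swap
  · rintro ⟨rfl, rfl⟩
    exact contiguous_full f (by omega)
  rintro ⟨-, -, hcon⟩
  have hk := numBlocks_eq_blockIndex G (show 0 < n by omega)
  have hmono := blockIndex_mono G
  have hsurj : ∀ l, blockIndex G x ≤ l → l ≤ blockIndex G (y - 1) →
      ∃ u, x ≤ u ∧ u < y ∧ blockIndex G u = l := fun l l1 l2 => by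
    obtain ⟨u, u1, u2, u3⟩ := exists_blockIndex_eq l1 (y - 1 - x)
      (by rwa [show x + (y - 1 - x) = y - 1 by omega])
    exact ⟨u, u1, by omega, u3⟩
  have hI : blockIndex G x < blockIndex G (y - 1) := blockIndex_lt hc hxc (by omega)
  have hJ : blockIndex G (y - 1) ≤ blockIndex G (n - 1) := hmono (by omega)
  have hmem : ∀ v p q, v < n → blockIndex G x ≤ p → p ≤ blockIndex G (y - 1) →
      blockIndex G x ≤ q → q ≤ blockIndex G (y - 1) → π p < π (blockIndex G v) →
      π (blockIndex G v) < π q → x ≤ v ∧ v < y := by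
    intro v p q hv p1 p2 q1 q2 e1 e2
    obtain ⟨u, u1, u2, rfl⟩ := hsurj p p1 p2
    obtain ⟨w, w1, w2, rfl⟩ := hsurj q q1 q2
    refine hcon u v w u1 u2 w1 w2 hv ((h.across u v (by omega) hv ?_).2 e1)
      ((h.across v w hv (by omega) ?_).2 e2)
    · intro he; rw [he] at e1; exact lt_irrefl _ e1
    · intro he; rw [he] at e2; exact lt_irrefl _ e2
  have h0 : blockIndex G 0 = 0 := by simp [blockIndex]
  -- Simplicity of `π` makes the set meet every block.
  have hfull : blockIndex G x = 0 ∧ blockIndex G (y - 1) + 1 = numBlocks n G := by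
    by_contra hcon'
    obtain ⟨l, hl, hl', p, q, p1, p2, q1, q2, e1, e2⟩ := hπ _ _ hI (by omega) (by omega)
    obtain ⟨v, v1, v2, rfl⟩ := exists_blockIndex_eq (G := G) (x := 0) (l := l) (by omega) (n - 1)
      (by rw [zero_add]; omega)
    obtain ⟨t1, t2⟩ := hmem v p q (by omega) p1 p2 q1 q2 e1 e2
    have := hmono t1
    have := hmono (show v ≤ y - 1 by omega)
    omega
  -- Meeting the first and last blocks is not yet containing them. Simplicity for all blocks but the
  -- first places block `0` between two others, which forces the value `0` into the set; likewise
  -- for the last block.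
  constructor
  · obtain ⟨l, hl, hl', p, q, p1, p2, q1, q2, e1, e2⟩ := hπ 1 (numBlocks n G - 1) (by omega)
      (by omega) (by omega)
    obtain rfl : l = 0 := by omega
    have := hmem 0 p q (by omega) (by omega) (by omega) (by omega) (by omega) (by rwa [h0])
      (by rwa [h0])
    omega
  · obtain ⟨l, hl, hl', p, q, p1, p2, q1, q2, e1, e2⟩ := hπ 0 (numBlocks n G - 2) (by omega)
      (by omega) (by omega)
    obtain rfl : l = blockIndex G (n - 1) := by omega
    have := hmem (n - 1) p q (by omega) (by omega) (by omega) (by omega) (by omega) e1 e2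
    omega

end IsInflation

/-! ### Simple arrangements and the realization of trees. -/

/-- A simple arrangement of `[0, k)` for `4 ≤ k`: the odd values in increasing order, then `0`,
then the other even values in decreasing order. -/
def simpleArrangement (k v : ℕ) : ℕ :=
  if v % 2 = 1 then v else if v = 0 then k else 2 * k + 1 - v

theorem simpleArrangement_injOn (k : ℕ) : Set.InjOn (simpleArrangement k) (Set.Iio k) := by
  intro u hu v hv h
  simp only [Set.mem_Iio] at hu hv
  simp only [simpleArrangement] at h
  split_ifs at h <;> omega

/-- If `0 < i`, the range contains an odd and a positive even value, and `0` lies between them. If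
`i = 0`, an odd value beyond `j` lies between `1` and `0`; there is none only for `k` odd and `j = k
- 2`, and then `k - 1` lies between `0` and `2`. -/
theorem simpleArrangement_simple {k : ℕ} (hk : 4 ≤ k) (i j : ℕ) (hij : i < j) (hj : j < k)
    (hne : 0 < i ∨ j + 1 < k) : ∃ l < k, (l < i ∨ j < l) ∧
      ∃ p q, i ≤ p ∧ p ≤ j ∧ i ≤ q ∧ q ≤ j ∧ simpleArrangement k p < simpleArrangement k l ∧
        simpleArrangement k l < simpleArrangement k q := by
  have odd : ∀ v, v % 2 = 1 → simpleArrangement k v = v := fun v hv => by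
    simp [simpleArrangement, hv]
  have even : ∀ v, v % 2 = 0 → 0 < v → simpleArrangement k v = 2 * k + 1 - v := fun v hv h0 => by
    rw [simpleArrangement, if_neg (by omega), if_neg (by omega)]
  have zero : simpleArrangement k 0 = k := by simp [simpleArrangement]
  rcases Nat.eq_zero_or_pos i with rfl | hi
  · by_cases hkj : j + 2 < k ∨ k % 2 = 0
    · obtain ⟨M, h1, h2, h3⟩ : ∃ M, M % 2 = 1 ∧ M < k ∧ j < M := by
        rcases Nat.mod_two_eq_zero_or_one k with h | h
        · exact ⟨k - 1, by omega, by omega, by omega⟩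
        · exact ⟨k - 2, by omega, by omega, by omega⟩
      refine ⟨M, h2, Or.inr h3, 1, 0, by omega, by omega, by omega, by omega, ?_⟩
      rw [odd 1 rfl, odd M h1, zero]
      omega
    · refine ⟨k - 1, by omega, Or.inr (by omega), 0, 2, by omega, by omega, by omega, by omega, ?_⟩
      rw [zero, even 2 rfl (by omega), even (k - 1) (by omega) (by omega)]
      omega
  · obtain ⟨p, q, p1, p2, q1, q2, hp, hq⟩ : ∃ p q, i ≤ p ∧ p ≤ j ∧ i ≤ q ∧ q ≤ j ∧ p % 2 = 1 ∧
        q % 2 = 0 := by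
      rcases Nat.mod_two_eq_zero_or_one i with h | h
      · exact ⟨i + 1, i, by omega, by omega, by omega, by omega, by omega, by omega⟩
      · exact ⟨i, i + 1, by omega, by omega, by omega, by omega, by omega, by omega⟩
    refine ⟨0, by omega, Or.inl hi, p, q, p1, p2, q1, q2, ?_⟩
    rw [odd p hp, even q hq (by omega), zero]
    omega

/-- Every tree is the family of contiguous sets of an arrangement. -/
theorem exists_eq_contiguous {n : ℕ} {F : ℕ → ℕ → Prop} (hF : IsForest n F) (h0 : F 0 n) :
    ∃ f, Set.InjOn f (Set.Iio n) ∧ F = Contiguous n f := by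
  induction n using Nat.strong_induction_on generalizing F with
  | _ n ih =>
  have hn := hF.lt h0
  rcases (show 1 ≤ n from hn).eq_or_lt with rfl | hn2
  · refine ⟨id, fun _ _ _ _ h => h, ?_⟩
    rw [isForest_one_iff.1 hF, isForest_one_iff.1 (isForest_contiguous (f := id) fun _ _ _ _ h => h)]
  -- An interior cut makes every block shorter than `n`, so the induction hypothesis applies to it.
  have blocks : ∀ G, IsForest n G → 2 ≤ numBlocks n G → ∀ a b, IsBlock n G a b →
      ∃ f, Set.InjOn f (Set.Iio (b - a)) ∧ restr a b G = Contiguous (b - a) f := by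
    intro G hG h2 a b hab
    obtain ⟨c, c0, cn, hc⟩ := two_le_numBlocks_iff.1 h2
    obtain ⟨b1, b2, b3, b4, b5⟩ := hab
    refine ih (b - a) ?_ (hG.restr b2) ⟨by omega, ?_⟩
    · by_contra! hle
      exact b5 c (by omega) (by omega) hc
    · rw [zero_add, Nat.sub_add_cancel b1.le]
      exact hG.block b1 b2 b3 b4 b5
  by_cases hlin : HasLinearCut n F
  · set G := removeLinearTop n F with hGdef
    have hG : IsForest n G := hF.removeLinearTop
    have h2 : 2 ≤ numBlocks n G := hF.two_le_numBlocks_removeLinearTop h0 hlin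
    obtain ⟨f, hf⟩ := exists_isInflation hG (blocks G hG h2) (π := id) fun _ _ _ _ h => h
    refine ⟨f, hf.inj, ?_⟩
    rw [← linearTop_removeLinearTop hF h0, ← hGdef]
    funext x y
    refine propext ?_
    by_cases hxy : x < y ∧ y ≤ n
    swap
    · exact ⟨fun h => absurd ⟨hG.linearTop.lt h, hG.linearTop.le h⟩ hxy,
        fun h => absurd ⟨h.1, h.2.1⟩ hxy⟩
    obtain ⟨hxy, hy⟩ := hxy
    by_cases hno : ∀ c, x < c → c < y → ¬ IsCut G c
    · rw [hf.contiguous_iff_of_no_cut hxy hy hno]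
      refine ⟨?_, Or.inl⟩
      rintro (h | ⟨-, -, hx, hy'⟩)
      · exact h
      · exact hG.block hxy hy hx hy' hno
    · push Not at hno
      obtain ⟨c, hxc, hcy, hc⟩ := hno
      rw [hf.contiguous_iff_of_cut_linear hy hxc hcy hc]
      refine ⟨?_, fun h => Or.inr ⟨hxy, hy, h⟩⟩
      rintro (h | ⟨-, -, h⟩)
      · have := hc _ _ h hxc
        omega
      · exact h
  · set G := removePrimeTop n F with hGdef
    have hG : IsForest n G := hF.removePrimeTop hn2 hlin
    have h4 : 4 ≤ numBlocks n G := hF.four_le_numBlocks_removePrimeTop hn2 h0 hlin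
    obtain ⟨f, hf⟩ := exists_isInflation hG (blocks G hG (by omega))
      (simpleArrangement_injOn (numBlocks n G))
    refine ⟨f, hf.inj, ?_⟩
    rw [← primeTop_removePrimeTop h0, ← hGdef]
    funext x y
    refine propext ?_
    by_cases hxy : x < y ∧ y ≤ n
    swap
    · exact ⟨fun h => absurd ⟨(hG.primeTop h4).lt h, (hG.primeTop h4).le h⟩ hxy,
        fun h => absurd ⟨h.1, h.2.1⟩ hxy⟩
    obtain ⟨hxy, hy⟩ := hxy
    by_cases hno : ∀ c, x < c → c < y → ¬ IsCut G c
    · rw [hf.contiguous_iff_of_no_cut hxy hy hno]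
      refine ⟨?_, Or.inl⟩
      rintro (h | ⟨rfl, rfl⟩)
      · exact h
      · obtain ⟨c, c0, cn, hc, -⟩ := four_le_numBlocks_ne h4 0 0
        exact absurd hc (hno c c0 cn)
    · push Not at hno
      obtain ⟨c, hxc, hcy, hc⟩ := hno
      rw [hf.contiguous_iff_of_cut_simple (simpleArrangement_simple h4) (by omega) hy hxc hcy hc]
      refine ⟨?_, Or.inr⟩
      rintro (h | h)
      · have := hc _ _ h hxc
        omega
      · exact h

/-! ### Permutations as arrangements. -/

/-- The values in `[x, y)`, as a finset. -/
def valueInterval (m x y : ℕ) : Finset (Fin m) := Finset.univ.filter fun v => x ≤ v.1 ∧ v.1 < y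

theorem mem_valueInterval {m x y : ℕ} {v : Fin m} :
    v ∈ valueInterval m x y ↔ x ≤ v.1 ∧ v.1 < y := by simp [valueInterval]

/-- The intervals of `σ` as a family of half-open intervals. -/
def permFamily {m : ℕ} (σ : Equiv.Perm (Fin m)) (x y : ℕ) : Prop :=
  x < y ∧ y ≤ m ∧ IsPermInterval σ (valueInterval m x y)

/-- The position of a value. -/
def position {m : ℕ} (σ : Equiv.Perm (Fin m)) (v : ℕ) : ℕ :=
  if h : v < m then (σ.symm ⟨v, h⟩).1 else 0

theorem position_of_lt {m v : ℕ} (σ : Equiv.Perm (Fin m)) (h : v < m) :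
    position σ v = (σ.symm ⟨v, h⟩).1 := dif_pos h

theorem position_injOn {m : ℕ} (σ : Equiv.Perm (Fin m)) :
    Set.InjOn (position σ) (Set.Iio m) := by
  intro u hu v hv h
  rw [position_of_lt σ hu, position_of_lt σ hv] at h
  exact Fin.mk.inj_iff.1 (σ.symm.injective (Fin.ext h))

theorem permFamily_eq {m : ℕ} (σ : Equiv.Perm (Fin m)) :
    permFamily σ = Contiguous m (position σ) := by
  funext x y
  refine propext (and_congr_right fun hxy => and_congr_right fun hy => ?_)
  constructor
  · rintro ⟨a, b, c, d, hab, hcd, -, h⟩ u v w u1 u2 w1 w2 hv e1 e2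
    rw [position_of_lt σ (by omega), position_of_lt σ hv] at e1
    rw [position_of_lt σ (by omega), position_of_lt σ (by omega)] at e2
    have key : ∀ (t : ℕ) (ht : t < m), (x ≤ t ∧ t < y) ↔
        (a ≤ σ.symm ⟨t, ht⟩ ∧ σ.symm ⟨t, ht⟩ ≤ b) := by
      intro t ht
      have := Finset.ext_iff.1 h ⟨t, ht⟩
      rw [mem_valueInterval] at this
      rw [this, Finset.mem_image]
      constructor
      · rintro ⟨p, hp, hpt⟩
        rw [← hpt, Equiv.symm_apply_apply]
        exact Finset.mem_Icc.1 hp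
      · intro hp
        exact ⟨_, Finset.mem_Icc.2 hp, by simp⟩
    have h1 := (key u (by omega)).1 ⟨u1, u2⟩
    have h2 := (key w (by omega)).1 ⟨w1, w2⟩
    exact (key v hv).2 ⟨h1.1.trans (Fin.le_def.2 e1.le), (Fin.le_def.2 e2.le).trans h2.2⟩
  · intro h
    -- The required range of positions runs from the least to the greatest element of `P`;
    -- contiguity fills every place between.
    set P := (valueInterval m x y).image σ.symm with hP
    have hx : x < m := by omega
    have hy1 : y - 1 < m := by omega
    have hne : P.Nonempty := Finset.Nonempty.image
      ⟨(⟨x, hx⟩ : Fin m), mem_valueInterval.2 ⟨le_rfl, hxy⟩⟩ _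
    obtain ⟨u, hu, hua⟩ := Finset.mem_image.1 (P.min'_mem hne)
    obtain ⟨w, hw, hwb⟩ := Finset.mem_image.1 (P.max'_mem hne)
    refine ⟨P.min' hne, P.max' hne, ⟨x, hx⟩, ⟨y - 1, hy1⟩, P.min'_le_max' hne,
      Fin.mk_le_mk.2 (by omega), ?_, ?_⟩
    · ext v
      rw [mem_valueInterval, Finset.mem_Icc, Fin.le_def, Fin.le_def]
      dsimp only
      omega
    · ext v
      rw [Finset.mem_image]
      constructor
      · intro hv
        have hvP : σ.symm v ∈ P := Finset.mem_image_of_mem _ hv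
        exact ⟨σ.symm v, Finset.mem_Icc.2 ⟨P.min'_le _ hvP, P.le_max' _ hvP⟩, by simp⟩
      · rintro ⟨p, hp, rfl⟩
        obtain ⟨hp1, hp2⟩ := Finset.mem_Icc.1 hp
        rcases hp1.eq_or_lt with hp1 | hp1
        · rw [← hp1, ← hua, Equiv.apply_symm_apply]
          exact hu
        rcases hp2.eq_or_lt with hp2 | hp2
        · rw [hp2, ← hwb, Equiv.apply_symm_apply]
          exact hw
        rw [mem_valueInterval] at hu hw ⊢
        refine h u.1 (σ p).1 w.1 hu.1 hu.2 hw.1 hw.2 (σ p).2 ?_ ?_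
        · rw [position_of_lt σ u.2, position_of_lt σ (σ p).2]
          simpa [hua] using hp1
        · rw [position_of_lt σ w.2, position_of_lt σ (σ p).2]
          simpa [hwb] using hp2

theorem contiguous_congr {n : ℕ} {f g : ℕ → ℕ}
    (h : ∀ u v, u < n → v < n → (f u < f v ↔ g u < g v)) : Contiguous n f = Contiguous n g := by
  funext x y
  refine propext (and_congr_right fun hxy => and_congr_right fun hy => ?_)
  refine forall_congr' fun u => forall_congr' fun v => forall_congr' fun w => ?_
  refine imp_congr_right fun u1 => imp_congr_right fun u2 => imp_congr_right fun w1 =>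
    imp_congr_right fun w2 => imp_congr_right fun hv => ?_
  rw [h u v (by omega) hv, h v w hv (by omega)]

/-- Contiguity depends only on the relative order of the `f v`, and sorting by `f` gives a
permutation with that order. -/
theorem exists_perm_permFamily_eq {n : ℕ} {f : ℕ → ℕ} (hf : Set.InjOn f (Set.Iio n)) :
    ∃ σ : Equiv.Perm (Fin n), permFamily σ = Contiguous n f := by
  refine ⟨Tuple.sort fun v : Fin n => f v, ?_⟩
  set σ := Tuple.sort fun v : Fin n => f v with hσ
  have hmono : StrictMono ((fun v : Fin n => f v) ∘ σ) := by
    refine (Tuple.monotone_sort _).strictMono_of_injective ?_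
    refine Function.Injective.comp (fun u v h => ?_) σ.injective
    exact Fin.ext (hf u.2 v.2 h)
  rw [permFamily_eq]
  refine contiguous_congr fun u v hu hv => ?_
  rw [position_of_lt σ hu, position_of_lt σ hv, ← Fin.lt_def, ← hmono.lt_iff_lt]
  simp

theorem range_permFamily {n : ℕ} (hn : 0 < n) :
    Set.range (permFamily : Equiv.Perm (Fin n) → ℕ → ℕ → Prop) = ↑(forests n (· = 1)) := by
  ext F
  rw [Finset.mem_coe, mem_forests_one]
  constructor
  · rintro ⟨σ, rfl⟩
    rw [permFamily_eq]
    exact ⟨isForest_contiguous (position_injOn σ), contiguous_full _ hn⟩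
  · rintro ⟨hF, h0⟩
    obtain ⟨f, hf, rfl⟩ := exists_eq_contiguous hF h0
    exact exists_perm_permFamily_eq hf

theorem IsPermInterval.exists_valueInterval {m : ℕ} {σ : Equiv.Perm (Fin m)} {S : Finset (Fin m)}
    (h : IsPermInterval σ S) : ∃ x y, x < y ∧ y ≤ m ∧ S = valueInterval m x y := by
  obtain ⟨a, b, c, d, hab, hcd, hS, -⟩ := h
  have := Fin.le_def.1 hcd
  refine ⟨c.1, d.1 + 1, by omega, d.2, ?_⟩
  ext v
  rw [hS, mem_valueInterval, Finset.mem_Icc, Fin.le_def, Fin.le_def, Nat.lt_succ_iff]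

theorem permFamily_eq_iff {m : ℕ} {σ τ : Equiv.Perm (Fin m)} :
    permFamily σ = permFamily τ ↔ ∀ S, IsPermInterval σ S ↔ IsPermInterval τ S := by
  constructor
  · have key : ∀ σ τ : Equiv.Perm (Fin m), permFamily σ = permFamily τ → ∀ S,
        IsPermInterval σ S → IsPermInterval τ S := by
      intro σ τ h S hS
      obtain ⟨x, y, hxy, hy, rfl⟩ := hS.exists_valueInterval
      have : permFamily σ x y := ⟨hxy, hy, hS⟩
      rw [h] at this
      exact this.2.2
    exact fun h S => ⟨key σ τ h S, key τ σ h.symm S⟩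
  · intro h
    funext x y
    rw [permFamily, permFamily, h]

/-! ### Plane posets and their families of intervals. -/

/-- The singleton of a value as an interval of `σ`. -/
def singletonInterval {m : ℕ} (σ : Equiv.Perm (Fin m)) (i : Fin m) : PermInterval σ :=
  ⟨{i}, isPermInterval_singleton σ i⟩

theorem isMin_singletonInterval {m : ℕ} (σ : Equiv.Perm (Fin m)) (i : Fin m) :
    IsMin (singletonInterval σ i) := by
  intro T hT
  obtain ⟨x, y, hxy, hy, hS⟩ := T.2.exists_valueInterval
  have hx : (⟨x, by omega⟩ : Fin m) ∈ T.1 := by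
    rw [hS]
    exact mem_valueInterval.2 ⟨le_rfl, hxy⟩
  have := Finset.mem_singleton.1 (hT hx)
  exact Finset.singleton_subset_iff.2 (this ▸ hx)

theorem setOf_isMin_eq_range {m : ℕ} (σ : Equiv.Perm (Fin m)) :
    {S : PermInterval σ | IsMin S} = Set.range (singletonInterval σ) := by
  ext S
  constructor
  · intro hS
    obtain ⟨i, hi⟩ := PermInterval.eq_singleton_of_isMin hS
    exact ⟨i, Subtype.ext hi.symm⟩
  · rintro ⟨i, rfl⟩
    exact isMin_singletonInterval σ i

theorem numMinimal_intervalPoset {m : ℕ} (σ : Equiv.Perm (Fin m)) :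
    (intervalPoset σ).numMinimal = m := by
  have hinj : Function.Injective (singletonInterval σ) := fun i j h =>
    Finset.singleton_injective (congrArg Subtype.val h)
  change Set.ncard {S : PermInterval σ | IsMin S} = m
  rw [setOf_isMin_eq_range, ← Set.image_univ, Set.ncard_image_of_injective _ hinj,
    Set.ncard_univ, Nat.card_fin]

theorem same_intervalPoset_of_forall_iff {m : ℕ} {σ τ : Equiv.Perm (Fin m)}
    (h : ∀ S, IsPermInterval σ S ↔ IsPermInterval τ S) :
    PlanePoset.Same (intervalPoset σ) (intervalPoset τ) := by
  let e : PermInterval σ ≃o PermInterval τ :=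
    { toEquiv := Equiv.subtypeEquivRight h
      map_rel_iff' := Iff.rfl }
  exact ⟨e, fun S T _ _ => Iff.rfl⟩

/-- The isomorphism acts on singletons as a strictly increasing self-map of `Fin m`, hence as the
identity, and an interval is determined by the singletons below it. -/
theorem forall_iff_of_same_intervalPoset {m : ℕ} {σ τ : Equiv.Perm (Fin m)}
    (h : PlanePoset.Same (intervalPoset σ) (intervalPoset τ)) (S : Finset (Fin m)) :
    IsPermInterval σ S → IsPermInterval τ S := by
  obtain ⟨e, he⟩ := h
  change PermInterval σ ≃o PermInterval τ at e
  have hmin : ∀ i, ∃ j, (e (singletonInterval σ i)) = singletonInterval τ j := by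
    intro i
    obtain ⟨j, hj⟩ := PermInterval.eq_singleton_of_isMin
      ((OrderIso.isMin_apply e).2 (isMin_singletonInterval σ i))
    exact ⟨j, Subtype.ext hj⟩
  choose g hg using hmin
  have hgmono : StrictMono g := by
    intro i j hij
    obtain ⟨k, l, hk, hl, hkl⟩ := (he (singletonInterval σ i) (singletonInterval σ j)
      (isMin_singletonInterval σ i) (isMin_singletonInterval σ j)).1 ⟨i, j, rfl, rfl, hij⟩
    have hk' : ({g i} : Finset (Fin m)) = {k} := (congrArg Subtype.val (hg i)).symm.trans hk
    have hl' : ({g j} : Finset (Fin m)) = {l} := (congrArg Subtype.val (hg j)).symm.trans hl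
    rw [Finset.singleton_injective hk', Finset.singleton_injective hl']
    exact hkl
  have hgid : ∀ i, g i = i := by
    intro i
    have : g = id := by
      refine hgmono.range_inj strictMono_id |>.1 ?_
      rw [(Finite.surjective_of_injective hgmono.injective).range_eq, Set.range_id]
    rw [this, id]
  intro hS
  have : (e ⟨S, hS⟩).1 = S := by
    ext i
    have h1 : singletonInterval σ i ≤ ⟨S, hS⟩ ↔ i ∈ S := Finset.singleton_subset_iff
    have h2 : singletonInterval τ i ≤ e ⟨S, hS⟩ ↔ i ∈ (e ⟨S, hS⟩).1 :=
      Finset.singleton_subset_iff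
    rw [← h1, ← h2, ← e.le_iff_le, hg, hgid]
  rw [← this]
  exact (e ⟨S, hS⟩).2

theorem same_intervalPoset_iff {m : ℕ} {σ τ : Equiv.Perm (Fin m)} :
    PlanePoset.Same (intervalPoset σ) (intervalPoset τ) ↔ permFamily σ = permFamily τ := by
  rw [permFamily_eq_iff]
  exact ⟨fun h S => ⟨forall_iff_of_same_intervalPoset h S,
    forall_iff_of_same_intervalPoset (PlanePoset.same_equivalence.symm h) S⟩,
    same_intervalPoset_of_forall_iff⟩

/-! ### Modified interval posets through the inverse permutation. -/

theorem IsPermInterval.image_symm {m : ℕ} {σ : Equiv.Perm (Fin m)} {S : Finset (Fin m)}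
    (h : IsPermInterval σ S) : IsPermInterval σ.symm (S.image σ.symm) := by
  obtain ⟨a, b, c, d, hab, hcd, h1, h2⟩ := h
  refine ⟨c, d, a, b, hcd, hab, ?_, by rw [h1]⟩
  rw [h2, Finset.image_image]
  simp

/-- Passing from values to positions turns intervals of `σ` into intervals of its inverse. -/
def valuesToPositions {m : ℕ} (σ : Equiv.Perm (Fin m)) : PermInterval σ ≃o PermInterval σ.symm where
  toFun S := ⟨S.1.image σ.symm, S.2.image_symm⟩
  invFun S := ⟨S.1.image σ, S.2.image_symm⟩
  left_inv S := Subtype.ext (by simp [Finset.image_image])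
  right_inv S := Subtype.ext (by simp [Finset.image_image])
  map_rel_iff' := Finset.image_subset_image_iff σ.symm.injective

/-- Replacing values by positions turns the order `{σ 1}, {σ 2}, …` of the singletons into their
natural order. -/
theorem same_modifiedIntervalPoset {m : ℕ} (σ : Equiv.Perm (Fin m)) :
    PlanePoset.Same (modifiedIntervalPoset σ) (intervalPoset σ.symm) := by
  have key : ∀ (S : PermInterval σ) (i : Fin m),
      S.1 = {σ i} ↔ (valuesToPositions σ S).1 = {i} := by
    intro S i
    change _ ↔ S.1.image σ.symm = {i}
    rw [← (Finset.image_injective σ.symm.injective).eq_iff, Finset.image_singleton,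
      Equiv.symm_apply_apply]
  exact ⟨valuesToPositions σ, fun S T _ _ => exists_congr fun i => exists_congr fun j =>
    and_congr (key S i) (and_congr (key T j) Iff.rfl)⟩

theorem intervalPosets_eq_range (n : ℕ) : intervalPosets n =
    Set.range fun σ : Equiv.Perm (Fin n) => (⟦intervalPoset σ⟧ : PlanePosetClass) := by
  ext Q
  constructor
  · rintro ⟨m, σ, hm, rfl⟩
    rw [numMinimal_intervalPoset] at hm
    subst hm
    exact ⟨σ, rfl⟩
  · rintro ⟨σ, rfl⟩
    exact ⟨n, σ, numMinimal_intervalPoset σ, rfl⟩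

theorem modifiedIntervalPosets_eq (n : ℕ) : modifiedIntervalPosets n = intervalPosets n := by
  have hsame : ∀ {m : ℕ} (σ : Equiv.Perm (Fin m)),
      (⟦modifiedIntervalPoset σ⟧ : PlanePosetClass) = ⟦intervalPoset σ.symm⟧ :=
    fun σ => Quotient.sound (same_modifiedIntervalPoset σ)
  have hnum : ∀ {m : ℕ} (σ : Equiv.Perm (Fin m)), (modifiedIntervalPoset σ).numMinimal = m :=
    fun σ => numMinimal_intervalPoset σ
  ext Q
  constructor
  · rintro ⟨m, σ, hm, rfl⟩
    exact ⟨m, σ.symm, (numMinimal_intervalPoset _).trans ((hnum σ).symm.trans hm), hsame σ⟩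
  · rintro ⟨m, σ, hm, rfl⟩
    exact ⟨m, σ.symm, (hnum _).trans ((numMinimal_intervalPoset σ).symm.trans hm),
      (hsame σ.symm).symm⟩

/-! ### The final count. -/

theorem ncard_range_eq_of_eq_iff {α β γ : Type*} {f : α → β} {g : α → γ}
    (h : ∀ a b, f a = f b ↔ g a = g b) : (Set.range f).ncard = (Set.range g).ncard := by
  have hker : Setoid.ker f = Setoid.ker g := Setoid.ext h
  rw [← Nat.card_coe_set_eq, ← Nat.card_coe_set_eq,
    ← Nat.card_congr (Setoid.quotientKerEquivRange f),
    ← Nat.card_congr (Setoid.quotientKerEquivRange g), hker]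

theorem ncard_intervalPosets {n : ℕ} (hn : 0 < n) :
    (intervalPosets n).ncard = (forests n (· = 1)).card := by
  rw [intervalPosets_eq_range, ← Set.ncard_coe_finset, ← range_permFamily hn]
  exact ncard_range_eq_of_eq_iff fun σ τ => Quotient.eq.trans same_intervalPoset_iff

theorem mainTheorem5 (n : ℕ) (hn : 1 ≤ n) :
    (intervalPosets n).Finite ∧ ((intervalPosets n).ncard : ℚ) = intervalPosetFormula n ∧
    (modifiedIntervalPosets n).Finite ∧
      ((modifiedIntervalPosets n).ncard : ℚ) = intervalPosetFormula n := by
  have hfin : (intervalPosets n).Finite := by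
    rw [intervalPosets_eq_range]
    exact Set.finite_range _
  have hcard : ((intervalPosets n).ncard : ℚ) = intervalPosetFormula n := by
    rw [ncard_intervalPosets hn, card_trees_eq_formula hn]
  rw [modifiedIntervalPosets_eq]
  exact ⟨hfin, hcard, hfin, hcard⟩
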